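/- Let $\mathbb{F}$ be a field and, for $d\ge 1$, let $\mathbb{F}[x]_d$ be the space of polynomials of degree less than $d$. Algorithms are straight-line programs over $\mathbb{F}$, and their time is the number of arithmetic operations $+,-,\times,\div$ in $\mathbb{F}$ that they perform (constants of $\mathbb{F}$ are free; no division by zero may occur on any admissible input). Let $\mathscr{M}:\mathbb{N}_{>0}\to\mathbb{R}$ be a super-linear multiplication time for $\mathbb{F}[x]$: for every $d \ge 1$ two polynomials in $\mathbb{F}[x]_d$ can be multiplied in time at most $\mathscr{M}(d)$, and $d\mapsto \mathscr{M}(d)/d$ is nondecreasing. Let $\mathscr{M}_{\rm mat}:\mathbb{R}_{\ge 1}\times\mathbb{N}_{>0}\to\mathbb{R}$ be such that for all real $d\ge1$ and integers $n \ge 1$ two $n\times n$ matrices over $\mathbb{F}[x]_d$ can be multiplied in time at most $\mathscr{M}_{\rm mat}(d,n)$, and assume that $\mathscr{M}(\lceil d\rceil)=O(\mathscr{M}_{\rm mat}(d,1))$, uniformly for real $d \ge 1$. Define $$\mathscr{M}'_{\rm mat}(d,n)=\sum_{k=0}^{\log_2 \overline n}2^k\,\mathscr{M}_{\rm mat}\!\left(2^kd,\frac{\overline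 n}{2^k}\right),$$ where $\overline n$ is the smallest power of two greater than or equal to $n$. Then there is a constant $C$ such that the following holds for all integers $m,n,\alpha,\beta\ge1$ with $\alpha\le n$. Write $p=\max(m,n)$, $\alpha'=\min(\alpha,\beta)$ and $\beta'=\max(\alpha,\beta)$. There is an algorithm that takes as input (the coefficients of) an arbitrary monic polynomial $Q\in\mathbb{F}[x]$ of degree $n$ and polynomials $U_1,\dots,U_\alpha\in\mathbb{F}[x]_m$ and $V_1,\dots,V_\alpha,W_1,\dots,W_\beta\in\mathbb{F}[x]_n$, and that computes (the coefficients of) the polynomials $$R_i=\sum_{k=1}^{\alpha}U_k\,(V_kW_i \bmod Q)\in\mathbb{F}[x]_{m+n-1},\qquad i=1,\dots,\beta,$$ in time at most $$C\,\frac{\beta'}{\alpha'}\,\mathscr{M}'_{\rm mat}\!\left(\frac{p}{\alpha'},\alpha'\right).$$ -/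

import Mathlib

open Polynomial

/-! ### Straight-line programs over a field, with a count of the arithmetic operations -/

/-- The four arithmetic operations of a field. -/
inductive ArithOp : Type
  | add | sub | mul | div

open Classical in
/-- Result of an arithmetic operation; a division by zero has no result. -/
noncomputable def ArithOp.eval {F : Type*} [Field F] : ArithOp → F → F → Option F
  | .add, a, b => some (a + b)
  | .sub, a, b => some (a - b)
  | .mul, a, b => some (a * b)
  | .div, a, b => if b = 0 then none else some (a / b)

/-- What an operation may refer to: a constant of the field, one of the inputs (indexed by `ι`),
or the result `reg j` of the operation number `j` (counted from zero) of the program. -/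
inductive Operand (F ι : Type*) : Type _
  | const (c : F)
  | input (i : ι)
  | reg (j : ℕ)

/-- Value of an operand, for the inputs `x` and the list `mem` of the results obtained so far.
A reference to a result which is not yet available has no value. -/
def Operand.eval {F ι : Type*} (x : ι → F) (mem : List F) : Operand F ι → Option F
  | .const c => some c
  | .input i => some (x i)
  | .reg j => mem[j]?

/-- A single arithmetic operation on two operands. -/
structure Instr (F ι : Type*) : Type _ where
  op : ArithOp
  left : Operand F ι
  right : Operand F ι

/-- The result of a single operation, if there is one. -/
noncomputable def Instr.eval {F ι : Type*} [Field F] (x : ι → F) (mem : List F)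
    (I : Instr F ι) : Option F :=
  (I.left.eval x mem).bind fun a => (I.right.eval x mem).bind fun b => I.op.eval a b

/-- Perform a list of operations one after the other, appending each result to `mem`;
there is no outcome if one of the operations has no result. -/
noncomputable def runCode {F ι : Type*} [Field F] (x : ι → F) :
    List (Instr F ι) → List F → Option (List F)
  | [], mem => some mem
  | I :: rest, mem => (I.eval x mem).bind fun c => runCode x rest (mem ++ [c])

/-- A straight-line program over `F` with inputs indexed by `ι` and outputs indexed by `κ`. -/
structure SLP (F ι κ : Type*) : Type _ where
  code : List (Instr F ι)
  out : κ → Operand F ι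

/-- The time of a program: the number of arithmetic operations it performs. -/
def SLP.cost {F ι κ : Type*} (P : SLP F ι κ) : ℕ := P.code.length

/-- On the inputs `x` the program `P` runs without failure and returns the outputs `y`. -/
def SLP.Yields {F ι κ : Type*} [Field F] (P : SLP F ι κ) (x : ι → F) (y : κ → F) : Prop :=
  ∃ mem : List F, runCode x P.code [] = some mem ∧ ∀ k, (P.out k).eval x mem = some (y k)

/-! ### Multiplication times

`Polynomial.degreeLT F d` is the space `F[x]_d` of the polynomials of degree less than `d`. -/

/-- `M` is a (super-linear) multiplication time for `F[x]`: for all `d ≥ 1`, two polynomials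
of degree less than `d` can be multiplied in at most `M d` arithmetic operations,
and `d ↦ M d / d` is nondecreasing. -/
structure IsMulTime (F : Type*) [Field F] (M : ℕ → ℝ) : Prop where
  feasible : ∀ d : ℕ, 0 < d →
    ∃ P : SLP F (Fin d ⊕ Fin d) (Fin (2 * d - 1)),
      (P.cost : ℝ) ≤ M d ∧
      ∀ a ∈ degreeLT F d, ∀ b ∈ degreeLT F d,
        P.Yields (Sum.elim (fun s => a.coeff s) (fun s => b.coeff s))
          (fun t => (a * b).coeff t)
  superlinear : ∀ m n : ℕ, 0 < m → m ≤ n → M m / m ≤ M n / n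

/-- `Mmat` is a multiplication time for polynomial matrices: for all real `d ≥ 1` and all
`n ≥ 1`, two `n × n` matrices with entries in `F[x]` of degree less than `d`
(equivalently, less than `⌈d⌉`) can be multiplied in at most `Mmat d n` arithmetic operations. -/
def IsMatMulTime (F : Type*) [Field F] (Mmat : ℝ → ℕ → ℝ) : Prop :=
  ∀ (d : ℝ) (n : ℕ), 1 ≤ d → 0 < n →
    ∃ P : SLP F ((Fin n × Fin n × Fin ⌈d⌉₊) ⊕ (Fin n × Fin n × Fin ⌈d⌉₊))
        (Fin n × Fin n × Fin (2 * ⌈d⌉₊ - 1)),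
      (P.cost : ℝ) ≤ Mmat d n ∧
      ∀ A B : Matrix (Fin n) (Fin n) F[X],
        (∀ i j, A i j ∈ degreeLT F ⌈d⌉₊) → (∀ i j, B i j ∈ degreeLT F ⌈d⌉₊) →
        P.Yields (Sum.elim (fun s => (A s.1 s.2.1).coeff s.2.2)
            (fun s => (B s.1 s.2.1).coeff s.2.2))
          (fun t => ((A * B) t.1 t.2.1).coeff t.2.2)

/-- The smallest power of two which is at least `n` (for `n ≥ 1`). -/
def nextPowTwo (n : ℕ) : ℕ := 2 ^ Nat.clog 2 n

/-- The function `M'_mat(d, n) = ∑_{k=0}^{log n̄} 2^k M_mat(2^k d, n̄ / 2^k)`, where `n̄` is the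
smallest power of two which is at least `n`. -/
noncomputable def MmatPrime (Mmat : ℝ → ℕ → ℝ) (d : ℝ) (n : ℕ) : ℝ :=
  ∑ k ∈ Finset.range (Nat.log 2 (nextPowTwo n) + 1),
    (2 : ℝ) ^ k * Mmat ((2 : ℝ) ^ k * d) (nextPowTwo n / 2 ^ k)

/-! ### The problem -/

/-- `R_i = ∑_k U_k (V_k W_i mod Q)`. -/
noncomputable def sumModProd {F : Type*} [Field F] {α β : ℕ} (Q : F[X])
    (U V : Fin α → F[X]) (W : Fin β → F[X]) (i : Fin β) : F[X] :=
  ∑ k, U k * ((V k * W i) %ₘ Q)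

/-- Index type of the inputs: the `m` coefficients of each `U_k`, the `n` coefficients of each
`V_k` and of each `W_i`, and the `n` coefficients of the monic polynomial `Q` of degree `n`
other than the leading one. -/
abbrev ProblemInput (m n α β : ℕ) : Type :=
  (Fin α × Fin m) ⊕ (Fin α × Fin n) ⊕ (Fin β × Fin n) ⊕ Fin n

/-- The input coefficients of an instance. -/
noncomputable def problemInput {F : Type*} [Field F] (m n : ℕ) {α β : ℕ} (Q : F[X])
    (U V : Fin α → F[X]) (W : Fin β → F[X]) : ProblemInput m n α β → F :=
  Sum.elim (fun s => (U s.1).coeff s.2) <| Sum.elim (fun s => (V s.1).coeff s.2) <|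
    Sum.elim (fun s => (W s.1).coeff s.2) (fun s => Q.coeff s)

/-! Division by `Q` is traded for truncation modulo a power of `X`. Power series inversion of the
reversed `Q` gives `J` with `X^(n+P) - J Q` of degree less than `n`. Put `W'_i = ⌊W_i J / X^n⌋`;
then `s_ki = ⌊V_k W'_i / X^P⌋` is exactly the quotient of `V_k W_i` by `Q`. With `Z = ∑ U_k V_k` and
`E_i = ∑ U_k s_ki` this gives `R_i = Z W_i - E_i Q` and `X^P E_i = Z W'_i - T_i`, where `T_i = ∑ U_k
(V_k W'_i mod X^P)`. Everything except `T_i` costs `O(α + β)` products of size `p`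
(`IsMulTime.comp_sum_mul_modByMonic`).

For `T_i`, cut `V` and `W` into `c` blocks of `g` coefficients, `c g = P`, and let `truncAntidiag g
c` be the sum of the truncated products of blocks with indices adding up to `c - 1`. For `c = 1` it
is the product modulo `X^P`. Splitting every block in two halves gives `truncAntidiag (2g) c =
evenAntidiag g c + X^g * truncAntidiag g (2c)` (`truncAntidiag_two_mul`). The even part involves no
truncation, so `∑ U_k (V_k W_i)` may be reassociated as `(∑ U_k V_k) W_i`, which avoids a cost in `α
β`; at block size `2^k h` it is a few products of matrices of size `2^(L-k)`. These costs add up to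
`M'_mat`.

Linear overheads are absorbed by lower bounds for the multiplication times, obtained by counting
independent outputs.

Programs are handled through the functions on the set `Ω` of all inputs that they compute:
polynomials have coefficients in the ring `Ω → F`, and `Comp S c T` records costs. -/

section Model

/-! ### Functions of the input and the number of operations needed to obtain them -/

variable {F Ω : Type*}

/-- The elements of `S` together with the constant functions. -/
def withConsts (S : Set (Ω → F)) : Set (Ω → F) := S ∪ Set.range (Function.const Ω)

theorem subset_withConsts (S : Set (Ω → F)) : S ⊆ withConsts S := Set.subset_union_left

theorem const_mem_withConsts (S : Set (Ω → F)) (c : F) : Function.const Ω c ∈ withConsts S :=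
  Or.inr ⟨c, rfl⟩

theorem withConsts_mono {S S' : Set (Ω → F)} (h : S ⊆ S') : withConsts S ⊆ withConsts S' :=
  Set.union_subset_union_left _ h

theorem withConsts_subset_of_subset {S T : Set (Ω → F)} (h : S ⊆ withConsts T) :
    withConsts S ⊆ withConsts T :=
  Set.union_subset h Set.subset_union_right

theorem Operand.exists_eval_eq [Nonempty Ω] {ι : Type*} {x : ι → Ω → F} {L : List (Ω → F)}
    {S : Set (Ω → F)} (hx : ∀ i, x i ∈ withConsts S) (hL : ∀ a ∈ L, a ∈ S) (o : Operand F ι)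
    (h : ∀ ω, ∃ v, o.eval (fun i => x i ω) (L.map fun a => a ω) = some v) :
    ∃ a ∈ withConsts S, ∀ ω, o.eval (fun i => x i ω) (L.map fun a => a ω) = some (a ω) := by
  cases o with
  | const c => exact ⟨_, const_mem_withConsts S c, fun ω => rfl⟩
  | input i => exact ⟨x i, hx i, fun ω => rfl⟩
  | reg j =>
    -- The number of available results is the same for all inputs, so one input decides whether the
    -- register exists.
    obtain ⟨v, hv⟩ := h (Classical.arbitrary Ω)
    have hj : j < L.length := by
      by_contra hj
      simp [Operand.eval, List.getElem?_eq_none (not_lt.1 hj)] at hv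
    refine ⟨L[j], subset_withConsts _ (hL _ (List.getElem_mem hj)), fun ω => ?_⟩
    simp [Operand.eval, hj]

theorem exists_operand_of_mem_withConsts {ι : Type*} {x : ι → Ω → F} {L : List (Ω → F)}
    {S : Set (Ω → F)} (hS : ∀ a ∈ S, a ∈ Set.range x ∨ a ∈ L) {a : Ω → F}
    (ha : a ∈ withConsts S) :
    ∃ o : Operand F ι, ∀ ω, o.eval (fun i => x i ω) (L.map fun a => a ω) = some (a ω) := by
  rcases ha with ha | ⟨c, rfl⟩
  · rcases hS a ha with ⟨i, rfl⟩ | ha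
    · exact ⟨.input i, fun ω => rfl⟩
    · obtain ⟨j, hj, rfl⟩ := List.mem_iff_getElem.1 ha
      exact ⟨.reg j, fun ω => by simp [Operand.eval, hj]⟩
  · exact ⟨.const c, fun ω => rfl⟩

variable [Field F]

/-- `Reach S n T`: all functions of `T` can be obtained from those of `S` and the constants by `n`
arithmetic operations. -/
inductive Reach : Set (Ω → F) → ℕ → Set (Ω → F) → Prop
  | done {S T : Set (Ω → F)} (h : T ⊆ withConsts S) : Reach S 0 T
  | step {S T : Set (Ω → F)} {n : ℕ} (op : ArithOp) (a b z : Ω → F) (ha : a ∈ withConsts S)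
      (hb : b ∈ withConsts S) (hz : ∀ ω, op.eval (a ω) (b ω) = some (z ω))
      (h : Reach (insert z S) n T) : Reach S (n + 1) T

theorem Reach.mono_left {S T : Set (Ω → F)} {n : ℕ} (h : Reach S n T) :
    ∀ {S' : Set (Ω → F)}, S ⊆ withConsts S' → Reach S' n T := by
  induction h with
  | done h => exact fun hS => .done (h.trans (withConsts_subset_of_subset hS))
  | step op a b z ha hb hz _ ih =>
    intro S' hS
    have hS2 := withConsts_subset_of_subset hS
    refine .step op a b z (hS2 ha) (hS2 hb) hz (ih ?_)
    exact Set.insert_subset (subset_withConsts _ (Set.mem_insert _ _))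
      (hS.trans (withConsts_mono (Set.subset_insert _ _)))

theorem Reach.bind {S T T' : Set (Ω → F)} {n n' : ℕ} (h : Reach S n T)
    (h' : ∀ S', S ⊆ S' → T ⊆ withConsts S' → Reach S' n' T') : Reach S (n + n') T' := by
  induction h with
  | done h => simpa using h' _ subset_rfl h
  | step op a b z ha hb hz _ ih =>
    rw [add_right_comm]
    exact .step op a b z ha hb hz
      (ih fun S' hS hT => h' S' ((Set.subset_insert _ _).trans hS) hT)

/-- `Comp S c T`: all functions of `T` can be obtained from those of `S` and the constants by at
most `c` arithmetic operations. -/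
def Comp (S : Set (Ω → F)) (c : ℝ) (T : Set (Ω → F)) : Prop :=
  ∃ n : ℕ, (n : ℝ) ≤ c ∧ Reach S n T

theorem Comp.of_subset {S T : Set (Ω → F)} (h : T ⊆ withConsts S) : Comp S 0 T :=
  ⟨0, by simp, .done h⟩

theorem Comp.mono_left {S S' T : Set (Ω → F)} {c : ℝ} (h : Comp S c T) (hS : S ⊆ withConsts S') :
    Comp S' c T :=
  let ⟨n, hn, h⟩ := h
  ⟨n, hn, h.mono_left hS⟩

theorem Comp.mono_cost {S T : Set (Ω → F)} {c c' : ℝ} (h : Comp S c T) (hc : c ≤ c') :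
    Comp S c' T :=
  let ⟨n, hn, h⟩ := h
  ⟨n, hn.trans hc, h⟩

/-- Sequential composition. The continuation receives an abstract `S'` containing the old and the
new functions, so that later steps need not describe the intermediate results. -/
theorem Comp.bind {S T T' : Set (Ω → F)} {c c' : ℝ} (h : Comp S c T)
    (h' : ∀ S', S ⊆ S' → T ⊆ withConsts S' → Comp S' c' T') : Comp S (c + c') T' := by
  obtain ⟨n, hn, h⟩ := h
  -- Instantiating at the smallest possible `S'` fixes one operation count; `Reach.mono_left` then
  -- serves every other `S'`.
  obtain ⟨n', hn', h''⟩ := h' (S ∪ T) Set.subset_union_left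
    (Set.subset_union_right.trans (subset_withConsts _))
  refine ⟨n + n', by push_cast; linarith, h.bind fun S' hS hT => h''.mono_left ?_⟩
  exact Set.union_subset (hS.trans (subset_withConsts _)) hT

theorem Comp.mono_right {S T T' : Set (Ω → F)} {c : ℝ} (h : Comp S c T)
    (hT : T' ⊆ withConsts T) : Comp S c T' := by
  simpa using h.bind fun S' _ h' => .of_subset (hT.trans (withConsts_subset_of_subset h'))

theorem Comp.union {S T T' : Set (Ω → F)} {c c' : ℝ} (h : Comp S c T) (h' : Comp S c' T') :
    Comp S (c + c') (T ∪ T') := by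
  refine h.bind fun S' hS hT => ?_
  simpa using (h'.mono_left (hS.trans (subset_withConsts _))).bind fun S'' hS' hT' =>
    .of_subset (Set.union_subset (hT.trans (withConsts_mono hS')) hT')

theorem Comp.biUnion {ι : Type*} {S : Set (Ω → F)} {T : ι → Set (Ω → F)} {c : ι → ℝ}
    (s : Finset ι) (h : ∀ i ∈ s, Comp S (c i) (T i)) :
    Comp S (∑ i ∈ s, c i) (⋃ i ∈ s, T i) := by
  classical
  induction s using Finset.induction_on with
  | empty => simpa using Comp.of_subset (Set.empty_subset _)
  | insert a s ha ih =>
    rw [Finset.sum_insert ha, Finset.set_biUnion_insert]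
    exact (h a (Finset.mem_insert_self _ _)).union
      (ih fun i hi => h i (Finset.mem_insert_of_mem hi))

theorem Comp.iUnion {ι : Type*} [Fintype ι] {S : Set (Ω → F)} {T : ι → Set (Ω → F)} {c : ℝ}
    (h : ∀ i, Comp S c (T i)) : Comp S (Fintype.card ι * c) (⋃ i, T i) := by
  simpa using Comp.biUnion (c := fun _ => c) Finset.univ fun i _ => h i

theorem Comp.op {S : Set (Ω → F)} {a b z : Ω → F} (op : ArithOp) (ha : a ∈ withConsts S)
    (hb : b ∈ withConsts S) (hz : ∀ ω, op.eval (a ω) (b ω) = some (z ω)) : Comp S 1 {z} :=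
  ⟨1, by simp, .step op a b z ha hb hz
    (.done (Set.singleton_subset_iff.2 (subset_withConsts _ (Set.mem_insert _ _))))⟩

/-! ### From programs to reachability and back -/

/-- The program is run on all inputs at once: the list `L` of functions plays the role of the
memory, and its values at `ω` are the memory for the input `ω`. -/
theorem Reach.of_runCode [Nonempty Ω] {ι κ : Type*} {x : ι → Ω → F} {y : κ → Ω → F}
    (out : κ → Operand F ι) (code : List (Instr F ι)) :
    ∀ (L : List (Ω → F)) (S : Set (Ω → F)), (∀ i, x i ∈ withConsts S) → (∀ a ∈ L, a ∈ S) →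
      (∀ ω, ∃ mem, runCode (fun i => x i ω) code (L.map fun a => a ω) = some mem ∧
        ∀ k, (out k).eval (fun i => x i ω) mem = some (y k ω)) →
      Reach S code.length (Set.range y) := by
  induction code with
  | nil =>
    intro L S hx hL h
    refine .done ?_
    rintro _ ⟨k, rfl⟩
    have h' : ∀ ω, (out k).eval (fun i => x i ω) (L.map fun a => a ω) = some (y k ω) := by
      intro ω
      obtain ⟨mem, h1, h2⟩ := h ω
      simp only [runCode, Option.some.injEq] at h1
      exact h1 ▸ h2 k
    obtain ⟨a, ha, ha'⟩ := Operand.exists_eval_eq hx hL (out k) fun ω => ⟨_, h' ω⟩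
    have : y k = a := funext fun ω => by simpa [ha' ω] using (h' ω).symm
    exact this ▸ ha
  | cons I code ih =>
    intro L S hx hL h
    have h' : ∀ ω, ∃ a b z,
        I.left.eval (fun i => x i ω) (L.map fun a => a ω) = some a ∧
        I.right.eval (fun i => x i ω) (L.map fun a => a ω) = some b ∧
        I.op.eval a b = some z ∧
        ∃ mem, runCode (fun i => x i ω) code ((L.map fun a => a ω) ++ [z]) = some mem ∧
          ∀ k, (out k).eval (fun i => x i ω) mem = some (y k ω) := by
      intro ω
      obtain ⟨mem, h1, h2⟩ := h ω
      simp only [runCode, Instr.eval, Option.bind_eq_some_iff] at h1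
      obtain ⟨z, ⟨a, ha, b, hb, hz⟩, h3⟩ := h1
      exact ⟨a, b, z, ha, hb, hz, mem, h3, h2⟩
    choose a b z ha hb hz hmem using h'
    obtain ⟨a', ha1, ha2⟩ := Operand.exists_eval_eq hx hL I.left fun ω => ⟨_, ha ω⟩
    obtain ⟨b', hb1, hb2⟩ := Operand.exists_eval_eq hx hL I.right fun ω => ⟨_, hb ω⟩
    obtain rfl : a = a' := funext fun ω => by simpa [ha2 ω] using (ha ω).symm
    obtain rfl : b = b' := funext fun ω => by simpa [hb2 ω] using (hb ω).symm
    refine .step I.op a b z ha1 hb1 hz (ih (L ++ [z]) _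
      (fun i => withConsts_mono (Set.subset_insert _ _) (hx i)) ?_ ?_)
    · intro c hc
      rcases List.mem_append.1 hc with hc | hc
      · exact Set.mem_insert_of_mem _ (hL c hc)
      · simp_all
    · intro ω
      simpa using hmem ω

theorem SLP.comp [Nonempty Ω] {ι κ : Type*} (P : SLP F ι κ) {x : ι → Ω → F} {y : κ → Ω → F}
    (h : ∀ ω, P.Yields (fun i => x i ω) fun k => y k ω) {S : Set (Ω → F)}
    (hx : ∀ i, x i ∈ withConsts S) : Comp S P.cost (Set.range y) :=
  ⟨_, le_rfl, Reach.of_runCode P.out P.code [] S hx (by simp) fun ω => by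
    simpa [SLP.Yields] using h ω⟩

theorem Reach.exists_code {ι : Type*} {x : ι → Ω → F} {S T : Set (Ω → F)} {n : ℕ}
    (h : Reach S n T) : ∀ L : List (Ω → F), (∀ a ∈ S, a ∈ Set.range x ∨ a ∈ L) →
      ∃ (code : List (Instr F ι)) (L' : List (Ω → F)), code.length = n ∧
        (∀ ω, runCode (fun i => x i ω) code (L.map fun a => a ω) = some (L'.map fun a => a ω)) ∧
        ∀ t ∈ T, ∃ o : Operand F ι, ∀ ω,
          o.eval (fun i => x i ω) (L'.map fun a => a ω) = some (t ω) := by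
  induction h with
  | done h =>
    intro L hS
    exact ⟨[], L, rfl, fun ω => rfl, fun t ht => exists_operand_of_mem_withConsts hS (h ht)⟩
  | step op a b z ha hb hz _ ih =>
    intro L hS
    obtain ⟨oa, hoa⟩ := exists_operand_of_mem_withConsts hS ha
    obtain ⟨ob, hob⟩ := exists_operand_of_mem_withConsts hS hb
    obtain ⟨code, L', hlen, hrun, hout⟩ := ih (L ++ [z]) (by
      rintro c (rfl | hc)
      · simp
      · rcases hS c hc with hc | hc
        · exact .inl hc
        · simp [hc])
    refine ⟨⟨op, oa, ob⟩ :: code, L', by simp [hlen], fun ω => ?_, hout⟩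
    have := hrun ω
    simp only [List.map_append, List.map_cons, List.map_nil] at this
    simp [runCode, Instr.eval, hoa, hob, hz, this]

theorem Comp.exists_slp {ι κ : Type*} {x : ι → Ω → F} {y : κ → Ω → F} {c : ℝ}
    (h : Comp (Set.range x) c (Set.range y)) :
    ∃ P : SLP F ι κ, (P.cost : ℝ) ≤ c ∧ ∀ ω, P.Yields (fun i => x i ω) fun k => y k ω := by
  obtain ⟨n, hn, h⟩ := h
  obtain ⟨code, L', hlen, hrun, hout⟩ := h.exists_code (x := x) [] (by simp)
  choose out hout using fun k => hout (y k) ⟨k, rfl⟩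
  refine ⟨⟨code, out⟩, ?_, fun ω => ⟨L'.map fun a => a ω, by simpa using hrun ω, fun k => hout k ω⟩⟩
  simpa [SLP.cost, hlen] using hn

theorem runCode_length {ι : Type*} {x : ι → F} (code : List (Instr F ι)) :
    ∀ {mem mem' : List F}, runCode x code mem = some mem' →
      mem'.length = mem.length + code.length := by
  induction code with
  | nil => simp [runCode]
  | cons I code ih =>
    intro mem mem' h
    simp only [runCode, Option.bind_eq_some_iff] at h
    obtain ⟨z, _, h⟩ := h
    have := ih h
    simp only [List.length_append, List.length_cons, List.length_nil] at this ⊢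
    omega

/-- A program with sufficiently independent outputs performs an operation for each of them. -/
theorem SLP.card_le_cost {ι κ : Type*} [Fintype κ] (P : SLP F ι κ) (x : Ω → ι → F)
    (y : Ω → κ → F) (h : ∀ ω, P.Yields (x ω) (y ω))
    (hout : ∀ k, ∃ ω, y ω k = 1 ∧ ∀ k', k' ≠ k → y ω k' = 0)
    (hin : ∀ i, ∃ ω, x ω i = 1 ∧ ∀ k, y ω k = 0) (hzero : ∃ ω, ∀ k, y ω k = 0) :
    Fintype.card κ ≤ P.cost := by
  -- An output takes both values 0 and 1, so it is no constant; it vanishes somewhere where a given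
  -- input is 1, so it is not that input.
  have hreg : ∀ k, ∃ j : Fin P.cost, P.out k = .reg j := by
    intro k
    obtain ⟨ω, hω, -⟩ := hout k
    obtain ⟨mem, hmem, he⟩ := h ω
    have he := he k
    cases ho : P.out k with
    | const c =>
      obtain ⟨ω', hω'⟩ := hzero
      obtain ⟨mem', -, he'⟩ := h ω'
      have he' := he' k
      simp only [ho, Operand.eval, Option.some.injEq] at he he'
      simp [← he, he', hω'] at hω
    | input i =>
      obtain ⟨ω', h1, h0⟩ := hin i
      obtain ⟨mem', -, he'⟩ := h ω'
      have he' := he' k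
      simp [ho, Operand.eval, h1, h0] at he'
    | reg j =>
      refine ⟨⟨j, ?_⟩, rfl⟩
      simp only [ho, Operand.eval] at he
      have := (List.getElem?_eq_some_iff.1 he).1
      rw [runCode_length _ hmem] at this
      simpa [SLP.cost] using this
  choose j hj using hreg
  -- Outputs stored in the same register would agree everywhere, but one can be 1 while the others
  -- vanish.
  have hinj : Function.Injective j := by
    intro k k' hk
    by_contra hne
    obtain ⟨ω, h1, h0⟩ := hout k
    obtain ⟨mem, -, he⟩ := h ω
    have e1 := he k
    have e2 := he k'
    rw [hj, hk, ← hj, e2, h1, h0 k' (Ne.symm hne)] at e1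
    simp at e1
  simpa using Fintype.card_le_of_injective j hinj

end Model

/-! ### Polynomials cut into blocks of coefficients -/

section DegreeLT

variable {R : Type*} [CommRing R]

theorem mem_degreeLT_iff_coeff {f : R[X]} {n : ℕ} :
    f ∈ degreeLT R n ↔ ∀ s, n ≤ s → f.coeff s = 0 := by
  rw [mem_degreeLT, degree_lt_iff_coeff_zero]

theorem degreeLT_mul_mem {f g : R[X]} {a b c : ℕ} (hf : f ∈ degreeLT R a) (hg : g ∈ degreeLT R b)
    (h : a + b ≤ c + 1) : f * g ∈ degreeLT R c := by
  rw [mem_degreeLT_iff_coeff] at *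
  intro s hs
  rw [coeff_mul]
  refine Finset.sum_eq_zero fun x hx => ?_
  have := Finset.HasAntidiagonal.mem_antidiagonal.1 hx
  by_cases h1 : a ≤ x.1
  · rw [hf _ h1, zero_mul]
  · rw [hg _ (by omega), mul_zero]

theorem degreeLT_mono' {f : R[X]} {a b : ℕ} (hf : f ∈ degreeLT R a) (h : a ≤ b) :
    f ∈ degreeLT R b :=
  degreeLT_mono h hf

theorem X_pow_mul_mem_degreeLT {f : R[X]} {a s c : ℕ} (hf : f ∈ degreeLT R a) (h : s + a ≤ c) :
    X ^ s * f ∈ degreeLT R c := by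
  rw [mem_degreeLT_iff_coeff] at *
  intro r hr
  rw [coeff_X_pow_mul', if_pos (by omega), hf _ (by omega)]

/-- The block number `a` of `g` consecutive coefficients of `f`. -/
noncomputable def blk (g : ℕ) (f : R[X]) (a : ℕ) : R[X] :=
  ∑ s ∈ Finset.range g, monomial s (f.coeff (a * g + s))

theorem coeff_blk (g : ℕ) (f : R[X]) (a s : ℕ) :
    (blk g f a).coeff s = if s < g then f.coeff (a * g + s) else 0 := by
  simp [blk, finsetSum_coeff, coeff_monomial]

theorem blk_mem_degreeLT (g : ℕ) (f : R[X]) (a : ℕ) : blk g f a ∈ degreeLT R g := by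
  rw [mem_degreeLT_iff_coeff]
  intro s hs
  rw [coeff_blk, if_neg (by omega)]

theorem sum_X_pow_mul_blk {f : R[X]} {c g : ℕ} (hf : f ∈ degreeLT R (c * g)) :
    ∑ a ∈ Finset.range c, X ^ (a * g) * blk g f a = f := by
  rw [mem_degreeLT_iff_coeff] at hf
  ext s
  simp only [finsetSum_coeff, coeff_X_pow_mul', coeff_blk]
  rcases Nat.eq_zero_or_pos g with rfl | hg
  · simp [hf]
  rw [Finset.sum_eq_single (s / g)]
  · rw [if_pos (Nat.div_mul_le_self s g), if_pos, Nat.add_sub_cancel' (Nat.div_mul_le_self s g)]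
    have := Nat.lt_div_mul_add (a := s) hg
    omega
  · intro b _ hb
    by_cases h1 : b * g ≤ s
    · rw [if_pos h1, if_neg]
      intro h2
      apply hb
      symm
      rw [Nat.div_eq_iff hg]
      constructor
      · linarith
      · have : s < b * g + g := by omega
        omega
    · rw [if_neg h1]
  · intro h
    have : c * g ≤ s := by
      have h := not_lt.1 (Finset.mem_range.not.1 h)
      exact (Nat.mul_le_mul_right g h).trans (Nat.div_mul_le_self s g)
    split_ifs
    · rw [Nat.add_sub_cancel' (by assumption), hf _ this]
    · rfl
    · rfl

end DegreeLT

/-! ### Costs of operations on polynomials and polynomial matrices -/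

section PolynomialCosts

variable {F Ω : Type*} [Field F]

/-- The coefficients of `f` belong to `S` or are constants. -/
def Known (S : Set (Ω → F)) (f : (Ω → F)[X]) : Prop := ∀ s, f.coeff s ∈ withConsts S

/-- The set of the coefficients of `f`. -/
def coefs (f : (Ω → F)[X]) : Set (Ω → F) := Set.range f.coeff

theorem coefs_subset {S : Set (Ω → F)} {f : (Ω → F)[X]} :
    coefs f ⊆ withConsts S ↔ Known S f :=
  Set.range_subset_iff

theorem iUnion_coefs_subset {ι : Sort*} {S : Set (Ω → F)} {f : ι → (Ω → F)[X]} :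
    (⋃ i, coefs (f i)) ⊆ withConsts S ↔ ∀ i, Known S (f i) := by
  simp [Set.iUnion_subset_iff, coefs_subset]

theorem Known.mono {S S' : Set (Ω → F)} {f : (Ω → F)[X]} (h : Known S f) (hS : S ⊆ S') :
    Known S' f :=
  fun s => withConsts_mono hS (h s)

theorem zero_mem_withConsts (S : Set (Ω → F)) : (0 : Ω → F) ∈ withConsts S :=
  const_mem_withConsts S 0

theorem one_mem_withConsts (S : Set (Ω → F)) : (1 : Ω → F) ∈ withConsts S :=
  const_mem_withConsts S 1

theorem known_zero (S : Set (Ω → F)) : Known S 0 := fun s => by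
  simpa using zero_mem_withConsts S

theorem known_one (S : Set (Ω → F)) : Known S 1 := fun s => by
  rw [coeff_one]
  split_ifs
  exacts [one_mem_withConsts S, zero_mem_withConsts S]

theorem known_C_const (S : Set (Ω → F)) (c : F) : Known S (C (Function.const Ω c)) := fun s => by
  rw [coeff_C]
  split_ifs
  exacts [const_mem_withConsts S c, zero_mem_withConsts S]

theorem Known.of_coeff {S : Set (Ω → F)} {f g : (Ω → F)[X]} (hf : Known S f)
    (h : ∀ s, g.coeff s = 0 ∨ ∃ s', g.coeff s = f.coeff s') : Known S g := fun s => by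
  rcases h s with h | ⟨s', h⟩
  · rw [h]; exact zero_mem_withConsts S
  · rw [h]; exact hf s'

theorem Known.blk {S : Set (Ω → F)} {f : (Ω → F)[X]} (hf : Known S f) (g a : ℕ) :
    Known S (blk g f a) :=
  hf.of_coeff fun s => by
    rw [coeff_blk]
    split_ifs
    exacts [.inr ⟨_, rfl⟩, .inl rfl]

theorem Known.of_X_pow_mul {S : Set (Ω → F)} {f : (Ω → F)[X]} {a : ℕ} (hf : Known S (X ^ a * f)) :
    Known S f :=
  hf.of_coeff fun s => .inr ⟨s + a, by rw [coeff_X_pow_mul]⟩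

theorem Comp.of_union {S T T' : Set (Ω → F)} {c : ℝ} (h : Comp S c T)
    (hT : T' ⊆ withConsts (S ∪ T)) : Comp S c T' := by
  simpa using h.bind fun S' hS h' => .of_subset (hT.trans (withConsts_subset_of_subset
    (Set.union_subset (hS.trans (subset_withConsts _)) h')))

/-- Only the `e` coefficients met by the shifted `f` need an addition; all others are those of `g`,
whose degree is therefore irrelevant. -/
theorem Comp.add_X_pow_mul {S : Set (Ω → F)} {f g : (Ω → F)[X]} {e : ℕ} (s : ℕ)
    (hf : f ∈ degreeLT _ e) (kf : Known S f) (kg : Known S g) :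
    Comp S e (coefs (g + X ^ s * f)) := by
  have h := Comp.biUnion (S := S) (T := fun r => {g.coeff (s + r) + f.coeff r}) (c := fun _ => 1)
    (Finset.range e) fun r _ => Comp.op .add (kg (s + r)) (kf r) fun ω => rfl
  rw [Finset.sum_const, Finset.card_range, nsmul_eq_mul, mul_one] at h
  refine h.of_union (coefs_subset.2 fun r => ?_)
  rw [coeff_add, coeff_X_pow_mul']
  split_ifs with hs
  · by_cases hr : r - s < e
    · refine subset_withConsts _ (.inr ?_)
      simp only [Set.mem_iUnion]
      refine ⟨r - s, Finset.mem_range.2 hr, ?_⟩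
      rw [Nat.add_sub_cancel' hs]
      rfl
    · rw [mem_degreeLT_iff_coeff.1 hf _ (not_lt.1 hr), add_zero]
      exact withConsts_mono Set.subset_union_left (kg r)
  · rw [add_zero]
    exact withConsts_mono Set.subset_union_left (kg r)

theorem Comp.sub {S : Set (Ω → F)} {f g : (Ω → F)[X]} {e : ℕ}
    (hg : g ∈ degreeLT _ e) (kf : Known S f) (kg : Known S g) :
    Comp S e (coefs (f - g)) := by
  have h := Comp.biUnion (S := S) (T := fun r => {f.coeff r - g.coeff r}) (c := fun _ => 1)
    (Finset.range e) fun r _ => Comp.op .sub (kf r) (kg r) fun ω => rfl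
  rw [Finset.sum_const, Finset.card_range, nsmul_eq_mul, mul_one] at h
  refine h.of_union (coefs_subset.2 fun r => ?_)
  rw [coeff_sub]
  by_cases hr : r < e
  · refine subset_withConsts _ (.inr ?_)
    simp only [Set.mem_iUnion]
    exact ⟨r, Finset.mem_range.2 hr, rfl⟩
  · rw [mem_degreeLT_iff_coeff.1 hg _ (not_lt.1 hr), sub_zero]
    exact withConsts_mono Set.subset_union_left (kf r)

theorem Comp.sum_X_pow_mul {ι : Type*} {S : Set (Ω → F)} (s : Finset ι) (sh : ι → ℕ)
    {f : ι → (Ω → F)[X]} {e : ℕ} (hf : ∀ i ∈ s, f i ∈ degreeLT _ e)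
    (kf : ∀ i ∈ s, Known S (f i)) :
    Comp S (s.card * e) (coefs (∑ i ∈ s, X ^ sh i * f i)) := by
  classical
  induction s using Finset.induction_on with
  | empty => simpa using Comp.of_subset (coefs_subset.2 (known_zero S))
  | insert a s ha ih =>
    rw [Finset.sum_insert ha, Finset.card_insert_of_notMem ha, add_comm (_ * _)]
    push_cast
    rw [add_mul, one_mul]
    refine (ih (fun i hi => hf i (Finset.mem_insert_of_mem hi))
      fun i hi => kf i (Finset.mem_insert_of_mem hi)).bind fun S' hS hT => ?_
    exact .add_X_pow_mul _ (hf a (Finset.mem_insert_self _ _))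
      ((kf a (Finset.mem_insert_self _ _)).mono hS) (coefs_subset.1 hT)

theorem Comp.sum {ι : Type*} {S : Set (Ω → F)} (s : Finset ι)
    {f : ι → (Ω → F)[X]} {e : ℕ} (hf : ∀ i ∈ s, f i ∈ degreeLT _ e)
    (kf : ∀ i ∈ s, Known S (f i)) :
    Comp S (s.card * e) (coefs (∑ i ∈ s, f i)) := by
  simpa using Comp.sum_X_pow_mul s (fun _ => 0) hf kf

variable (F Ω) in
/-- Two polynomials with `e` coefficients can be multiplied in time `t`. -/
def MulLe (e : ℕ) (t : ℝ) : Prop :=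
  ∀ (S : Set (Ω → F)) (f g : (Ω → F)[X]), f ∈ degreeLT _ e → g ∈ degreeLT _ e →
    Known S f → Known S g → Comp S t (coefs (f * g))

variable (F Ω) in
/-- Two `n × n` matrices of polynomials with `D` coefficients can be multiplied in time `t`. -/
def MatLe (n D : ℕ) (t : ℝ) : Prop :=
  ∀ (S : Set (Ω → F)) (A B : Matrix (Fin n) (Fin n) (Ω → F)[X]),
    (∀ i j, A i j ∈ degreeLT _ D) → (∀ i j, B i j ∈ degreeLT _ D) →
    (∀ i j, Known S (A i j)) → (∀ i j, Known S (B i j)) →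
    Comp S t (⋃ p : Fin n × Fin n, coefs ((A * B) p.1 p.2))

theorem map_eval_mem_degreeLT {f : (Ω → F)[X]} {e : ℕ} (hf : f ∈ degreeLT _ e) (ω : Ω) :
    f.map (Pi.evalRingHom (fun _ => F) ω) ∈ degreeLT F e := by
  rw [mem_degreeLT_iff_coeff] at *
  intro s hs
  simp [coeff_map, hf s hs]

theorem IsMulTime.mulLe [Nonempty Ω] {M : ℕ → ℝ} (hM : IsMulTime F M) {e : ℕ} (he : 0 < e) :
    MulLe F Ω e (M e) := by
  intro S f g hf hg kf kg
  obtain ⟨P, hP, hy⟩ := hM.feasible e he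
  have h := P.comp (S := S)
    (x := Sum.elim (fun s : Fin e => f.coeff s) (fun s : Fin e => g.coeff s))
    (y := fun t => (f * g).coeff t) (fun ω => ?_) ?_
  · refine (h.mono_cost hP).of_union (coefs_subset.2 fun s => ?_)
    by_cases hs : s < 2 * e - 1
    · exact subset_withConsts _ (.inr ⟨⟨s, hs⟩, rfl⟩)
    · rw [mem_degreeLT_iff_coeff.1 (degreeLT_mul_mem (c := 2 * e - 1) hf hg (by omega)) s
        (not_lt.1 hs)]
      exact zero_mem_withConsts _
  · convert hy _ (map_eval_mem_degreeLT hf ω) _ (map_eval_mem_degreeLT hg ω) using 1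
    · ext (i | i) <;> simp
    · ext i
      rw [← Polynomial.map_mul, coeff_map]
      rfl
  · rintro (i | i)
    exacts [kf i, kg i]

theorem IsMatMulTime.matLe [Nonempty Ω] {M : ℝ → ℕ → ℝ} (hM : IsMatMulTime F M) {d : ℝ} {n : ℕ}
    (hd : 1 ≤ d) (hn : 0 < n) : MatLe F Ω n ⌈d⌉₊ (M d n) := by
  intro S A B hA hB kA kB
  have hprog := hM d n hd hn
  have hD : 0 < ⌈d⌉₊ := Nat.ceil_pos.2 (by linarith)
  generalize ⌈d⌉₊ = D at *
  obtain ⟨P, hP, hy⟩ := hprog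
  have h := P.comp (S := S)
    (x := Sum.elim (fun s => (A s.1 s.2.1).coeff s.2.2) (fun s => (B s.1 s.2.1).coeff s.2.2))
    (y := fun t => ((A * B) t.1 t.2.1).coeff t.2.2) (fun ω => ?_) ?_
  · refine (h.mono_cost hP).of_union (iUnion_coefs_subset.2 fun p s => ?_)
    by_cases hs : s < 2 * D - 1
    · exact subset_withConsts _ (.inr ⟨⟨p.1, p.2, ⟨s, hs⟩⟩, rfl⟩)
    · have : (A * B) p.1 p.2 ∈ degreeLT _ (2 * D - 1) := by
        rw [Matrix.mul_apply]
        exact Submodule.sum_mem _ fun k _ => degreeLT_mul_mem (hA _ _) (hB _ _) (by omega)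
      rw [mem_degreeLT_iff_coeff.1 this s (not_lt.1 hs)]
      exact zero_mem_withConsts _
  · convert hy (A.map fun f => f.map (Pi.evalRingHom (fun _ => F) ω))
      (B.map fun f => f.map (Pi.evalRingHom (fun _ => F) ω))
      (fun i j => map_eval_mem_degreeLT (hA i j) ω)
      (fun i j => map_eval_mem_degreeLT (hB i j) ω) using 1
    · ext (i | i) <;> simp
    · ext i
      have := (Matrix.map_mul (f := mapRingHom (Pi.evalRingHom (fun _ => F) ω)) (L := A)
        (M := B))
      have := congrFun₂ this i.1 i.2.1
      simp only [coe_mapRingHom] at this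
      rw [← this, Matrix.map_apply, coeff_map]
      rfl
  · rintro (i | i)
    exacts [kA _ _ _, kB _ _ _]

theorem MatLe.mono {n D D' : ℕ} {t : ℝ} (h : MatLe F Ω n D t) (hD : D' ≤ D) : MatLe F Ω n D' t :=
  fun S A B hA hB => h S A B (fun i j => degreeLT_mono hD (hA i j))
    fun i j => degreeLT_mono hD (hB i j)

/-- Multiplication of larger polynomials by blocks. -/
theorem MulLe.blocks {e : ℕ} {t : ℝ} (h : MulLe F Ω e t) (c : ℕ) :
    MulLe F Ω (c * e) (c ^ 2 * (t + 2 * e)) := by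
  intro S f g hf hg kf kg
  have hcost : (c : ℝ) ^ 2 * (t + 2 * e) = Fintype.card (Fin c × Fin c) * t +
      (Finset.univ : Finset (Fin c × Fin c)).card * (2 * e : ℕ) := by
    simp
    ring
  rw [hcost]
  refine (Comp.iUnion (S := S) (T := fun p : Fin c × Fin c => coefs (blk e f p.1 * blk e g p.2))
    fun p => h S _ _ (blk_mem_degreeLT _ _ _) (blk_mem_degreeLT _ _ _) (kf.blk _ _)
      (kg.blk _ _)).bind fun S' _ hT => ?_
  have := Comp.sum_X_pow_mul (S := S') (e := 2 * e) (Finset.univ : Finset (Fin c × Fin c))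
    (fun p => p.1 * e + p.2 * e) (f := fun p => blk e f p.1 * blk e g p.2)
    (fun p _ => degreeLT_mul_mem (blk_mem_degreeLT _ _ _) (blk_mem_degreeLT _ _ _) (by omega))
    fun p _ => iUnion_coefs_subset.1 hT p
  convert this using 2
  conv_lhs => rw [← sum_X_pow_mul_blk hf, ← sum_X_pow_mul_blk hg]
  rw [Finset.sum_range, Finset.sum_range, Finset.sum_mul_sum, Fintype.sum_prod_type]
  refine Finset.sum_congr rfl fun a _ => Finset.sum_congr rfl fun b _ => ?_
  rw [pow_add]
  ring

/-- Padding matrices by zero rows and columns does not change the original entries of the product.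
-/
theorem sum_extend_mul_extend {R I J K : Type*} [CommRing R] [Fintype K] {I' J' K' : Type*}
    [Fintype K'] (eI : I ↪ I') (eJ : J ↪ J') (eK : K ↪ K') (A : I → K → R) (B : K → J → R)
    (i : I) (j : J) :
    ∑ q, Function.extend eK (Function.extend eI A 0 (eI i)) 0 q *
      Function.extend eJ (Function.extend eK B 0 q) 0 (eJ j) = ∑ k, A i k * B k j := by
  symm
  refine Fintype.sum_of_injective eK eK.injective _ _ (fun q hq => ?_) fun k => ?_
  · rw [Function.extend_apply' _ _ _ (by simpa using hq)]
    simp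
  · simp [eI.injective.extend_apply, eJ.injective.extend_apply, eK.injective.extend_apply]

theorem extend_extend_induction {R I K I' K' : Type*} [Zero R] (p : R → Prop) (h0 : p 0)
    (eI : I ↪ I') (eK : K ↪ K') (A : I → K → R) (hA : ∀ i k, p (A i k)) (i' : I') (k' : K') :
    p (Function.extend eK (Function.extend eI A 0 i') 0 k') := by
  by_cases hk : ∃ k, eK k = k'
  · obtain ⟨k, rfl⟩ := hk
    rw [eK.injective.extend_apply]
    by_cases hi : ∃ i, eI i = i'
    · obtain ⟨i, rfl⟩ := hi
      rw [eI.injective.extend_apply]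
      exact hA i k
    · rw [Function.extend_apply' _ _ _ hi]
      exact h0
  · rw [Function.extend_apply' _ _ _ hk]
    exact h0

/-- Multiplication of rectangular matrices by square blocks. -/
theorem MatLe.rect {n D : ℕ} {t : ℝ} (h : MatLe F Ω n D t) {I J K : Type*} [Fintype I]
    [Fintype J] [Fintype K] (u w v : ℕ) (hI : Fintype.card I ≤ u * n)
    (hK : Fintype.card K ≤ w * n) (hJ : Fintype.card J ≤ v * n) {S : Set (Ω → F)}
    {A : I → K → (Ω → F)[X]} {B : K → J → (Ω → F)[X]}
    (hA : ∀ i k, A i k ∈ degreeLT _ D) (hB : ∀ k j, B k j ∈ degreeLT _ D)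
    (kA : ∀ i k, Known S (A i k)) (kB : ∀ k j, Known S (B k j)) :
    Comp S (u * w * v * (t + n ^ 2 * (2 * D)))
      (⋃ p : I × J, coefs (∑ k, A p.1 k * B k p.2)) := by
  obtain ⟨eI⟩ := Function.Embedding.nonempty_of_card_le (α := I) (β := Fin u × Fin n) (by simpa)
  obtain ⟨eK⟩ := Function.Embedding.nonempty_of_card_le (α := K) (β := Fin w × Fin n) (by simpa)
  obtain ⟨eJ⟩ := Function.Embedding.nonempty_of_card_le (α := J) (β := Fin v × Fin n) (by simpa)
  let A' := fun p q => Function.extend eK (Function.extend eI A 0 p) 0 q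
  let B' := fun q r => Function.extend eJ (Function.extend eK B 0 q) 0 r
  have hA' : ∀ p q, A' p q ∈ degreeLT _ D := extend_extend_induction _ (zero_mem _) _ _ A hA
  have hB' : ∀ p q, B' p q ∈ degreeLT _ D := extend_extend_induction _ (zero_mem _) _ _ B hB
  have kA' : ∀ p q, Known S (A' p q) := extend_extend_induction _ (known_zero S) _ _ A kA
  have kB' : ∀ p q, Known S (B' p q) := extend_extend_induction _ (known_zero S) _ _ B kB
  let MA : Fin u → Fin w → Matrix (Fin n) (Fin n) (Ω → F)[X] :=
    fun a b => Matrix.of fun i j => A' (a, i) (b, j)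
  let MB : Fin w → Fin v → Matrix (Fin n) (Fin n) (Ω → F)[X] :=
    fun a b => Matrix.of fun i j => B' (a, i) (b, j)
  have hcost : (u : ℝ) * w * v * (t + n ^ 2 * (2 * D)) =
      Fintype.card (Fin u × Fin w × Fin v) * t +
      Fintype.card ((Fin u × Fin n) × (Fin v × Fin n)) *
        ((Finset.univ : Finset (Fin w)).card * (2 * D : ℕ)) := by
    simp
    ring
  rw [hcost]
  refine (Comp.iUnion (S := S) fun x : Fin u × Fin w × Fin v =>
    h S (MA x.1 x.2.1) (MB x.2.1 x.2.2) (fun i j => hA' _ _) (fun i j => hB' _ _)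
      (fun i j => kA' _ _) (fun i j => kB' _ _)).bind fun S' _ hT => ?_
  have hT' : ∀ a b c i j, Known S' ((MA a b * MB b c) i j) := fun a b c i j =>
    iUnion_coefs_subset.1 ((Set.subset_iUnion _ (a, b, c)).trans hT) (i, j)
  have hdeg : ∀ a b c i j, (MA a b * MB b c) i j ∈ degreeLT _ (2 * D) := by
    intro a b c i j
    rw [Matrix.mul_apply]
    exact Submodule.sum_mem _ fun k _ => degreeLT_mul_mem (hA' _ _) (hB' _ _) (by omega)
  have := Comp.iUnion (S := S') fun x : (Fin u × Fin n) × (Fin v × Fin n) =>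
    Comp.sum Finset.univ (fun b _ => hdeg x.1.1 b x.2.1 x.1.2 x.2.2)
      fun b _ => hT' x.1.1 b x.2.1 x.1.2 x.2.2
  refine this.mono_right (Set.iUnion_subset fun p => ?_)
  refine subset_trans (subset_trans (Eq.subset ?_) (Set.subset_iUnion _ (eI p.1, eJ p.2)))
    (subset_withConsts _)
  congr 1
  rw [← sum_extend_mul_extend eI eJ eK, Fintype.sum_prod_type]
  refine Finset.sum_congr rfl fun b _ => ?_
  rw [Matrix.mul_apply]
  rfl

/-! ### Lower bounds for multiplication times -/

/-- The products `X^a * X^b` isolate each of the `2e - 1 ≥ e` output coefficients, and pairing a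
monomial with 0 makes an input 1 and all outputs 0, as `SLP.card_le_cost` requires. -/
theorem IsMulTime.le {M : ℕ → ℝ} (hM : IsMulTime F M) {e : ℕ} (he : 0 < e) : (e : ℝ) ≤ M e := by
  obtain ⟨P, hP, hy⟩ := hM.feasible e he
  have hmon : ∀ s < e, (X ^ s : F[X]) ∈ degreeLT F e := fun s hs => by
    rw [mem_degreeLT]
    exact (degree_X_pow_le s).trans_lt (by exact_mod_cast hs)
  have h := P.card_le_cost (Ω := degreeLT F e × degreeLT F e) _ _
    (fun ω => hy ω.1 ω.1.2 ω.2 ω.2.2) ?_ ?_ ?_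
  · rw [Fintype.card_fin] at h
    exact le_trans (by exact_mod_cast (by omega : e ≤ P.cost)) hP
  · intro k
    obtain ⟨a, ha, b, hb, hab⟩ : ∃ a < e, ∃ b < e, a + b = (k : ℕ) := by
      have := k.2
      by_cases hk : (k : ℕ) < e
      · exact ⟨k, hk, 0, he, rfl⟩
      · exact ⟨e - 1, by omega, k - (e - 1), by omega, by omega⟩
    refine ⟨(⟨X ^ a, hmon a ha⟩, ⟨X ^ b, hmon b hb⟩), ?_, fun k' hk' => ?_⟩
    · simp [← pow_add, hab]
    · simp [← pow_add, hab, coeff_X_pow, Fin.val_inj, hk']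
  · rintro (i | i)
    · exact ⟨(⟨X ^ (i : ℕ), hmon i i.2⟩, 0), by simp, by simp⟩
    · exact ⟨(0, ⟨X ^ (i : ℕ), hmon i i.2⟩), by simp, by simp⟩
  · exact ⟨0, by simp⟩

/-- As for polynomials, with the products of `X^a` at position `(i, i)` and `X^b` at position `(i,
j)` isolating the output coefficients. -/
theorem IsMatMulTime.le {M : ℝ → ℕ → ℝ} (hM : IsMatMulTime F M) {d : ℝ} {n : ℕ}
    (hd : 1 ≤ d) (hn : 0 < n) : (n : ℝ) ^ 2 * ⌈d⌉₊ ≤ M d n := by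
  have hprog := hM d n hd hn
  have hD : 0 < ⌈d⌉₊ := Nat.ceil_pos.2 (by linarith)
  generalize ⌈d⌉₊ = D at *
  obtain ⟨P, hP, hy⟩ := hprog
  have hmon : ∀ s < D, (X ^ s : F[X]) ∈ degreeLT F D := fun s hs => by
    rw [mem_degreeLT]
    exact (degree_X_pow_le s).trans_lt (by exact_mod_cast hs)
  have hsingle : ∀ i j : Fin n, ∀ s < D, ∀ i' j',
      (Matrix.single i j (X ^ s) : Matrix (Fin n) (Fin n) F[X]) i' j' ∈ degreeLT F D := by
    intro i j s hs i' j'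
    rw [Matrix.single_apply]
    split_ifs
    exacts [hmon s hs, zero_mem _]
  let Ω := {A : Matrix (Fin n) (Fin n) F[X] // ∀ i j, A i j ∈ degreeLT F D}
  let zero : Ω := ⟨0, fun i j => zero_mem _⟩
  have h := P.card_le_cost (Ω := Ω × Ω) _ _ (fun ω => hy ω.1 ω.2 ω.1.2 ω.2.2) ?_ ?_ ?_
  · simp only [Fintype.card_prod, Fintype.card_fin] at h
    have h2 : n * (n * D) ≤ P.cost :=
      le_trans (Nat.mul_le_mul_left _ (Nat.mul_le_mul_left _ (by omega))) h
    refine le_trans ?_ hP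
    have : ((n * (n * D) : ℕ) : ℝ) ≤ P.cost := by exact_mod_cast h2
    push_cast at this
    linarith
  · rintro ⟨i, j, k⟩
    obtain ⟨a, ha, b, hb, hab⟩ : ∃ a < D, ∃ b < D, a + b = (k : ℕ) := by
      have := k.2
      by_cases hk : (k : ℕ) < D
      · exact ⟨k, hk, 0, hD, rfl⟩
      · exact ⟨D - 1, by omega, k - (D - 1), by omega, by omega⟩
    refine ⟨(⟨.single i i (X ^ a), hsingle i i a ha⟩, ⟨.single i j (X ^ b), hsingle i j b hb⟩),
      ?_, ?_⟩
    · simp [← pow_add, hab]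
    · rintro ⟨i', j', k'⟩ hk'
      simp only [Matrix.single_mul_single_same, ← pow_add, hab, Matrix.single_apply]
      split_ifs with hij
      · obtain ⟨rfl, rfl⟩ := hij
        rw [coeff_X_pow, if_neg]
        intro h
        exact hk' (by rw [Fin.ext h])
      · simp
  · rintro (⟨i, j, s⟩ | ⟨i, j, s⟩)
    · exact ⟨(⟨.single i j (X ^ (s : ℕ)), hsingle i j s s.2⟩, zero), by simp, by simp [zero]⟩
    · exact ⟨(zero, ⟨.single i j (X ^ (s : ℕ)), hsingle i j s s.2⟩), by simp, by simp [zero]⟩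
  · exact ⟨(zero, zero), by simp [zero]⟩

end PolynomialCosts

/-! ### Truncated products of blocks and the doubling identity -/

section Blocks

variable {R : Type*} [CommRing R]

theorem exists_eq_blk_zero_add (e : ℕ) (f : R[X]) : ∃ q, f = blk e f 0 + X ^ e * q := by
  have : X ^ e ∣ f - blk e f 0 := by
    rw [X_pow_dvd_iff]
    intro s hs
    simp [coeff_blk, hs]
  obtain ⟨q, hq⟩ := this
  exact ⟨q, by rw [← hq]; ring⟩

theorem blk_zero_eq_of_dvd {e : ℕ} {f r : R[X]} (hr : r ∈ degreeLT R e) (h : X ^ e ∣ f - r) :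
    blk e f 0 = r := by
  rw [X_pow_dvd_iff] at h
  rw [mem_degreeLT_iff_coeff] at hr
  ext s
  rw [coeff_blk]
  split_ifs with hs
  · simpa [sub_eq_zero] using h s hs
  · rw [hr s (not_lt.1 hs)]

theorem blk_zero_of_mem {e : ℕ} {f : R[X]} (hf : f ∈ degreeLT R e) : blk e f 0 = f :=
  blk_zero_eq_of_dvd hf (by simp)

theorem blk_sum {ι : Type*} (e : ℕ) (s : Finset ι) (f : ι → R[X]) (a : ℕ) :
    blk e (∑ i ∈ s, f i) a = ∑ i ∈ s, blk e (f i) a := by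
  ext r
  simp only [coeff_blk, finsetSum_coeff]
  split_ifs <;> simp

theorem blk_two_mul (g : ℕ) (f : R[X]) (a : ℕ) :
    blk (2 * g) f a = blk g f (2 * a) + X ^ g * blk g f (2 * a + 1) := by
  ext s
  simp only [coeff_blk, coeff_add, coeff_X_pow_mul']
  by_cases h1 : s < g
  · rw [if_pos (by omega), if_pos h1, if_neg (by omega), add_zero]
    congr 1
    ring
  · rw [if_neg h1, if_pos (not_lt.1 h1), zero_add]
    by_cases h2 : s < 2 * g
    · rw [if_pos h2, if_pos (by omega)]
      congr 1
      obtain ⟨r, rfl⟩ := Nat.exists_eq_add_of_le (not_lt.1 h1)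
      rw [Nat.add_sub_cancel_left]
      ring
    · rw [if_neg h2, if_neg (by omega)]

/-- Modulo `X^(2g)` the product `v₁ * w₁` disappears and the cross terms matter only modulo `X^g`,
while `v₀ * w₀` already fits and stays whole. -/
theorem blk_two_mul_mul {g : ℕ} {v₀ v₁ w₀ w₁ : R[X]} (hv : v₀ ∈ degreeLT R g)
    (hw : w₀ ∈ degreeLT R g) :
    blk (2 * g) ((v₀ + X ^ g * v₁) * (w₀ + X ^ g * w₁)) 0 =
      v₀ * w₀ + X ^ g * (blk g (v₀ * w₁) 0 + blk g (v₁ * w₀) 0) := by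
  obtain ⟨q₁, h₁⟩ := exists_eq_blk_zero_add g (v₀ * w₁)
  obtain ⟨q₂, h₂⟩ := exists_eq_blk_zero_add g (v₁ * w₀)
  refine blk_zero_eq_of_dvd ?_ ⟨q₁ + q₂ + v₁ * w₁, ?_⟩
  · exact add_mem (degreeLT_mul_mem hv hw (by omega)) (X_pow_mul_mem_degreeLT
      (add_mem (blk_mem_degreeLT g _ 0) (blk_mem_degreeLT g _ 0)) (by omega))
  · have hX : (X : R[X]) ^ (2 * g) = X ^ g * X ^ g := by rw [two_mul, pow_add]
    rw [hX]
    linear_combination X ^ g * h₁ + X ^ g * h₂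

/-- The antidiagonal sum of the products of `c` blocks of `g` coefficients, each of them
truncated to `g` coefficients. -/
noncomputable def truncAntidiag (g c : ℕ) (V W : R[X]) : R[X] :=
  ∑ a ∈ Finset.range c, blk g (blk g V a * blk g W (c - 1 - a)) 0

/-- The contribution of the even blocks to `truncAntidiag`. -/
noncomputable def evenAntidiag (g c : ℕ) (V W : R[X]) : R[X] :=
  ∑ a ∈ Finset.range c, blk g V (2 * a) * blk g W (2 * (c - 1 - a))

theorem sum_range_two_mul {A : Type*} [AddCommMonoid A] (f : ℕ → A) (c : ℕ) :
    ∑ a ∈ Finset.range (2 * c), f a = ∑ a ∈ Finset.range c, (f (2 * a) + f (2 * a + 1)) := by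
  induction c with
  | zero => simp
  | succ c ih =>
    rw [Finset.sum_range_succ, ← ih, mul_add, mul_one, Finset.sum_range_succ,
      Finset.sum_range_succ, add_assoc]

/-- The block `a` of size `2g` consists of the blocks `2a` and `2a + 1` of size `g`. The even-even
products survive untruncated; the even-odd ones have indices adding up to `2c - 1`, hence form the
antidiagonal for block size `g`. -/
theorem truncAntidiag_two_mul (g c : ℕ) (V W : R[X]) :
    truncAntidiag (2 * g) c V W =
      evenAntidiag g c V W + X ^ g * truncAntidiag g (2 * c) V W := by
  simp only [truncAntidiag, evenAntidiag]
  rw [sum_range_two_mul, Finset.mul_sum, ← Finset.sum_add_distrib]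
  refine Finset.sum_congr rfl fun a ha => ?_
  have ha := Finset.mem_range.1 ha
  rw [blk_two_mul g V, blk_two_mul g W,
    blk_two_mul_mul (blk_mem_degreeLT _ _ _) (blk_mem_degreeLT _ _ _),
    show 2 * c - 1 - 2 * a = 2 * (c - 1 - a) + 1 by omega,
    show 2 * c - 1 - (2 * a + 1) = 2 * (c - 1 - a) by omega]

theorem truncAntidiag_one {P : ℕ} {V W : R[X]} (hV : V ∈ degreeLT R P) (hW : W ∈ degreeLT R P) :
    truncAntidiag P 1 V W = blk P (V * W) 0 := by
  simp [truncAntidiag, blk_zero_of_mem hV, blk_zero_of_mem hW]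

theorem truncAntidiag_mem_degreeLT (g c : ℕ) (V W : R[X]) :
    truncAntidiag g c V W ∈ degreeLT R g :=
  Submodule.sum_mem _ fun _ _ => blk_mem_degreeLT _ _ _

end Blocks

/-! ### Approximate quotients in Euclidean division -/

section Division

variable {R : Type*} [CommRing R]

theorem mem_degreeLT_of_X_pow_mul {f : R[X]} {e n : ℕ} (h : X ^ e * f ∈ degreeLT R (e + n)) :
    f ∈ degreeLT R n := by
  rw [mem_degreeLT_iff_coeff] at *
  intro s hs
  have := h (s + e) (by omega)
  rwa [coeff_X_pow_mul] at this

/-- Division by a polynomial, from an approximate quotient. -/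
theorem sub_mul_mem_degreeLT_of_approx {Q A B I r s t y : R[X]} {n e : ℕ}
    (hQ : Q ∈ degreeLT R (n + 1)) (hA : A ∈ degreeLT R (e + 1)) (hr : r ∈ degreeLT R n)
    (ht : t ∈ degreeLT R e) (hB : B = I * Q + r) (hs : A * I = X ^ e * s + t)
    (hy : X ^ e * y = A * B) : y - s * Q ∈ degreeLT R n := by
  refine mem_degreeLT_of_X_pow_mul (e := e) ?_
  have : X ^ e * (y - s * Q) = t * Q + A * r := by
    rw [mul_sub, hy, hB]
    linear_combination Q * hs
  rw [this]
  exact add_mem (degreeLT_mul_mem ht hQ (by omega)) (degreeLT_mul_mem hA hr (by omega))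

/-- Reversal turns the lowest `N + 1` coefficients of `reflect n Q * Y`, which are those of 1, into
the highest ones of `Q * reflect N Y`. -/
theorem X_pow_sub_reflect_mul_mem_degreeLT {Q Y : R[X]} {n N : ℕ} (hQ : Q ∈ degreeLT R (n + 1))
    (hY : Y ∈ degreeLT R (N + 1)) (h : X ^ (N + 1) ∣ reflect n Q * Y - 1) :
    X ^ (n + N) - reflect N Y * Q ∈ degreeLT R n := by
  have hdeg : ∀ {f : R[X]} {k : ℕ}, f ∈ degreeLT R (k + 1) → f.natDegree ≤ k := by
    intro f k hf
    rw [mem_degreeLT_iff_coeff] at hf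
    exact natDegree_le_iff_coeff_eq_zero.2 fun s hs => hf s hs
  have hmem : ∀ {f : R[X]} {k : ℕ}, f.natDegree ≤ k → f ∈ degreeLT R (k + 1) := by
    intro f k hf
    rw [mem_degreeLT_iff_coeff]
    exact fun s hs => natDegree_le_iff_coeff_eq_zero.1 hf s hs
  have hG : (reflect n Q).natDegree ≤ n :=
    (natDegree_reflect_le).trans (max_le le_rfl (hdeg hQ))
  have hprod : reflect (n + N) (reflect n Q * Y) = Q * reflect N Y := by
    rw [reflect_mul _ _ hG (hdeg hY)]
    simp
  rw [X_pow_dvd_iff] at h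
  rw [mul_comm, ← hprod, mem_degreeLT_iff_coeff]
  intro s hs
  rw [coeff_sub, coeff_reflect, coeff_X_pow]
  by_cases hs' : s ≤ n + N
  · rw [revAt_le hs']
    have := h (n + N - s) (by omega)
    rw [coeff_sub, sub_eq_zero, coeff_one] at this
    rw [this]
    by_cases h2 : s = n + N
    · simp [h2]
    · rw [if_neg h2, if_neg (by omega), sub_zero]
  · rw [revAt_eq_self_of_lt (by omega), if_neg (by omega),
      mem_degreeLT_iff_coeff.1 (degreeLT_mul_mem (c := n + N + 1) (hmem hG) hY (by omega)) s
        (by omega), sub_zero]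

end Division

/-! ### Power series inversion by Newton iteration -/

section Newton

variable {F Ω : Type*} [Field F]

theorem Known.reflect {S : Set (Ω → F)} {f : (Ω → F)[X]} (hf : Known S f) (n : ℕ) :
    Known S (reflect n f) :=
  hf.of_coeff fun s => .inr ⟨_, coeff_reflect n f s⟩

theorem one_mem_degreeLT {R : Type*} [CommRing R] {e : ℕ} (he : 0 < e) :
    (1 : R[X]) ∈ degreeLT R e := by
  rw [mem_degreeLT_iff_coeff]
  intro s hs
  rw [coeff_one, if_neg (by omega)]

/-- The iteration `Y = Y₁ (2 - G Y₁)` squares the error: `G Y - 1 = -(G Y₁ - 1)^2`. The new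
precision `e` may be anything between `e₁` and `2 e₁`, which leaves room for rounding, and all
products are truncated to `e` coefficients. -/
theorem newton_step {G Y₁ : (Ω → F)[X]} {e₁ e : ℕ} {t : ℝ} (hY : Y₁ ∈ degreeLT _ e₁)
    (h : X ^ e₁ ∣ G * Y₁ - 1) (he₀ : 0 < e) (he₁ : e₁ ≤ e) (he : e ≤ 2 * e₁) (ht : MulLe F Ω e t) :
    ∃ Y ∈ degreeLT (Ω → F) e, X ^ e ∣ G * Y - 1 ∧
      ∀ S, Known S G → Known S Y₁ → Comp S (2 * t + e) (coefs Y) := by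
  have hY' := degreeLT_mono' hY he₁
  obtain ⟨q₀, hq₀⟩ := exists_eq_blk_zero_add e G
  set G' := blk e G 0 with hG'
  obtain ⟨q₁, hq₁⟩ := exists_eq_blk_zero_add e (G' * Y₁)
  set H := blk e (G' * Y₁) 0 with hH
  obtain ⟨q₂, hq₂⟩ := exists_eq_blk_zero_add e (Y₁ * (2 - H))
  have hHe : H ∈ degreeLT (Ω → F) e := blk_mem_degreeLT _ _ _
  have h2 : (2 : (Ω → F)[X]) ∈ degreeLT (Ω → F) e := by
    rw [← one_add_one_eq_two]
    exact add_mem (one_mem_degreeLT he₀) (one_mem_degreeLT he₀)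
  refine ⟨blk e (Y₁ * (2 - H)) 0, blk_mem_degreeLT _ _ _, ?_, fun S kG kY => ?_⟩
  · obtain ⟨z, hz⟩ := h
    have hX : (X : (Ω → F)[X]) ^ e₁ * X ^ e₁ = X ^ e * X ^ (2 * e₁ - e) := by
      rw [← pow_add, ← pow_add]
      congr 1
      omega
    refine ⟨Y₁ * G * (q₁ + q₀ * Y₁) - G * q₂ - X ^ (2 * e₁ - e) * z ^ 2, ?_⟩
    have hHG : H = G * Y₁ - X ^ e * (q₀ * Y₁ + q₁) := by
      linear_combination (-Y₁) * hq₀ - hq₁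
    have hYe : blk e (Y₁ * (2 - H)) 0 = Y₁ * (2 - H) - X ^ e * q₂ := by
      linear_combination -hq₂
    rw [hYe, hHG]
    linear_combination (-z ^ 2) * hX - (G * Y₁ - 1 + X ^ e₁ * z) * hz
  · have : 2 * t + e = t + (e + t) := by ring
    rw [this]
    refine (ht S G' Y₁ (blk_mem_degreeLT _ _ _) hY' (kG.blk _ _) kY).bind fun S₁ hS₁ hT₁ => ?_
    have kH : Known S₁ H := (coefs_subset.1 hT₁).blk _ _
    have k2 : Known S₁ 2 := by
      have := known_C_const S₁ (2 : F)
      exact this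
    refine (Comp.sub hHe k2 kH).bind fun S₂ hS₂ hT₂ => ?_
    exact (ht S₂ Y₁ _ hY' (sub_mem h2 hHe) ((kY.mono hS₁).mono hS₂)
      (coefs_subset.1 hT₂)).mono_right
        (coefs_subset.2 (Known.blk (coefs_subset.1 (subset_withConsts _)) _ _))

/-- Power series inversion. -/
theorem IsMulTime.exists_inverse [Nonempty Ω] {M : ℕ → ℝ} (hM : IsMulTime F M) {G : (Ω → F)[X]}
    (hG : G.coeff 0 = 1) (e : ℕ) (he : 0 < e) :
    ∃ Y ∈ degreeLT (Ω → F) e, X ^ e ∣ G * Y - 1 ∧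
      ∀ S, Known S G → Comp S (12 * M e) (coefs Y) := by
  induction e using Nat.strong_induction_on with
  | _ e ih =>
  have hMe := hM.le he
  rcases Nat.lt_or_ge e 2 with h | h
  · obtain rfl : e = 1 := by omega
    refine ⟨1, one_mem_degreeLT one_pos, ?_, fun S _ => ?_⟩
    · rw [X_pow_dvd_iff]
      intro s hs
      obtain rfl : s = 0 := by omega
      simp [hG]
    · push_cast at hMe
      exact (Comp.of_subset (coefs_subset.2 (known_one S))).mono_cost (by linarith)
  · obtain ⟨Y₁, hY₁, hd, hc⟩ := ih ((e + 1) / 2) (by omega) (by omega)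
    obtain ⟨Y, hY, hdY, hcY⟩ := newton_step hY₁ hd he (by omega) (by omega)
      (hM.mulLe (Ω := Ω) he)
    refine ⟨Y, hY, hdY, fun S kG => ?_⟩
    refine ((hc S kG).bind fun S' hS hT =>
      hcY S' (kG.mono hS) (coefs_subset.1 hT)).mono_cost ?_
    have hsup := hM.superlinear ((e + 1) / 2) e (by omega) (by omega)
    have hpos : (0 : ℝ) < ((e + 1) / 2 : ℕ) := by
      have : 0 < (e + 1) / 2 := by omega
      exact_mod_cast this
    have hepos : (0 : ℝ) < e := by exact_mod_cast he
    -- Since `⌈e/2⌉ ≤ 3e/4` for `e ≥ 2`, superlinearity bounds the recursive call by `12 * (3/4)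
    -- M(e) = 9 M(e)`, and the Newton step adds at most `3 M(e)`: this is where 12 comes from.
    have h34 : (((e + 1) / 2 : ℕ) : ℝ) ≤ 3 / 4 * e := by
      have : 4 * ((e + 1) / 2) ≤ 3 * e := by omega
      have : (4 : ℝ) * ((e + 1) / 2 : ℕ) ≤ 3 * e := by exact_mod_cast this
      linarith
    have hMpos : 0 ≤ M e / e := div_nonneg (by linarith) hepos.le
    rw [div_le_iff₀ hpos] at hsup
    have h5 : M ((e + 1) / 2) ≤ 3 / 4 * M e := by
      calc _ ≤ _ := hsup
        _ ≤ M e / e * (3 / 4 * e) := mul_le_mul_of_nonneg_left h34 hMpos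
        _ = 3 / 4 * M e := by field_simp
    linarith

/-- Nothing bounds `M(4e)` in terms of `M(e)`, so the last two doublings multiply by blocks of size
`e`. The costs are `12 + 26 + 100 = 138` times `M(e)`. -/
theorem IsMulTime.exists_inverse_four_mul [Nonempty Ω] {M : ℕ → ℝ} (hM : IsMulTime F M)
    {G : (Ω → F)[X]} (hG : G.coeff 0 = 1) (e : ℕ) (he : 0 < e) :
    ∃ Y ∈ degreeLT (Ω → F) (4 * e), X ^ (4 * e) ∣ G * Y - 1 ∧
      ∀ S, Known S G → Comp S (138 * M e) (coefs Y) := by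
  have hMe := hM.le he
  obtain ⟨Y₁, hY₁, hd₁, hc₁⟩ := hM.exists_inverse hG e he
  have hm := hM.mulLe (Ω := Ω) he
  obtain ⟨Y₂, hY₂, hd₂, hc₂⟩ := newton_step (e := 2 * e) hY₁ hd₁ (by omega) (by omega) (by omega)
    (hm.blocks 2)
  obtain ⟨Y₃, hY₃, hd₃, hc₃⟩ := newton_step (e := 4 * e) hY₂ hd₂ (by omega) (by omega) (by omega)
    (hm.blocks 4)
  refine ⟨Y₃, hY₃, hd₃, fun S kG => ?_⟩
  refine ((hc₁ S kG).bind fun S' hS hT => (hc₂ S' (kG.mono hS) (coefs_subset.1 hT)).bind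
    fun S'' hS' hT' => hc₃ S'' ((kG.mono hS).mono hS') (coefs_subset.1 hT')).mono_cost ?_
  push_cast
  linarith

end Newton

/-! ### Sums of truncated products by matrix multiplication -/

section Antidiagonal

variable {F Ω : Type*} [Field F]

/-- Base case of the doubling: the blocks of `V` times those of `W`, then the blocks of `U` times
the truncated result. Its cost contains `ρα * ρβ`, which is harmless only at the finest block size.
-/
theorem comp_sum_mul_truncAntidiag {n g : ℕ} {t : ℝ} (h : MatLe F Ω n g t)
    (hgt : (n : ℝ) ^ 2 * g ≤ t) {α β ρα ρβ : ℕ} (hα : α ≤ ρα * n) (hβ : β ≤ ρβ * n)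
    {S : Set (Ω → F)} {U V : Fin α → (Ω → F)[X]} {W : Fin β → (Ω → F)[X]}
    (hU : ∀ k, U k ∈ degreeLT _ (2 * n * g)) (kU : ∀ k, Known S (U k)) (kV : ∀ k, Known S (V k))
    (kW : ∀ i, Known S (W i)) :
    Comp S ((12 * (ρα * ρβ) + 4 * ρβ) * t)
      (⋃ i, coefs (∑ k, U k * truncAntidiag g (2 * n) (V k) (W i))) := by
  have h1 := h.rect ρα 2 ρβ (I := Fin α) (K := Fin (2 * n)) (J := Fin β) (S := S)
    (A := fun k a => blk g (V k) a) (B := fun a i => blk g (W i) (2 * n - 1 - a))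
    (by simpa) (by simp) (by simpa) (fun _ _ => blk_mem_degreeLT _ _ _)
    (fun _ _ => blk_mem_degreeLT _ _ _) (fun k _ => (kV k).blk _ _) (fun _ i => (kW i).blk _ _)
  have hcost : (ρα : ℝ) * (2 : ℕ) * ρβ * (t + n ^ 2 * (2 * g)) +
      ((2 : ℕ) * ρα * ρβ * (t + n ^ 2 * (2 * g)) +
        Fintype.card (Fin β) * ((Finset.univ : Finset (Fin (2 * n))).card * (2 * g : ℕ))) ≤
      (12 * (ρα * ρβ) + 4 * ρβ) * t := by
    have e1 : (0 : ℝ) ≤ ρα * ρβ * (t - n ^ 2 * g) := by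
      have : 0 ≤ t - n ^ 2 * g := by linarith
      positivity
    have e2 : (β : ℝ) * (n * g) ≤ ρβ * n * (n * g) := by
      have : (β : ℝ) ≤ ρβ * n := by exact_mod_cast hβ
      gcongr
    have e3 : (ρβ : ℝ) * (n ^ 2 * g) ≤ ρβ * t := by gcongr
    simp only [Fintype.card_fin, Finset.card_univ]
    push_cast
    linarith
  refine (h1.bind fun S₁ hS₁ hT₁ => ?_).mono_cost hcost
  have kT : ∀ k i, Known S₁ (truncAntidiag g (2 * n) (V k) (W i)) := fun k i => by
    -- Truncation is linear, so it may be applied, free of charge, to the entries of the matrix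
    -- product.
    rw [truncAntidiag, ← blk_sum, Finset.sum_range]
    exact (iUnion_coefs_subset.1 hT₁ (k, i)).blk _ _
  refine (h.rect 2 ρα ρβ (I := Fin (2 * n)) (K := Fin α) (J := Fin β) (S := S₁)
    (A := fun b k => blk g (U k) b) (B := fun k i => truncAntidiag g (2 * n) (V k) (W i))
    (by simp) (by simpa) (by simpa) (fun _ _ => blk_mem_degreeLT _ _ _)
    (fun _ _ => truncAntidiag_mem_degreeLT _ _ _ _) (fun _ k => ((kU k).mono hS₁).blk _ _)
    kT).bind fun S₂ hS₂ hT₂ => ?_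
  have h3 := Comp.iUnion (S := S₂) fun i : Fin β => Comp.sum_X_pow_mul (e := 2 * g)
    (Finset.univ : Finset (Fin (2 * n))) (fun b => b * g)
    (f := fun b => ∑ k, blk g (U k) b * truncAntidiag g (2 * n) (V k) (W i))
    (fun b _ => Submodule.sum_mem _ fun k _ => degreeLT_mul_mem (blk_mem_degreeLT _ _ _)
      (truncAntidiag_mem_degreeLT _ _ _ _) (by omega))
    fun b _ => iUnion_coefs_subset.1 hT₂ (b, i)
  convert h3 using 4 with i
  simp only [Finset.mul_sum]
  rw [Finset.sum_comm]
  refine Finset.sum_congr rfl fun k _ => ?_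
  simp only [← mul_assoc]
  rw [← Finset.sum_mul]
  congr 1
  conv_lhs => rw [← sum_X_pow_mul_blk (hU k)]
  rw [Finset.sum_range]

/-- Without truncation the triple product can be reassociated: the sum over the `α` indices comes
first and leaves a `2n × n` matrix, so the cost is linear in `wα` and `wβ` separately. -/
theorem comp_sum_mul_evenAntidiag {n g : ℕ} {t : ℝ} (h : MatLe F Ω n g t)
    (hgt : (n : ℝ) ^ 2 * g ≤ t) {α β wα wβ : ℕ} (hα : α ≤ wα * n) (hβ : β ≤ wβ * n)
    {S : Set (Ω → F)} {U V : Fin α → (Ω → F)[X]} {W : Fin β → (Ω → F)[X]}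
    (hU : ∀ k, U k ∈ degreeLT _ (2 * n * g)) (kU : ∀ k, Known S (U k)) (kV : ∀ k, Known S (V k))
    (kW : ∀ i, Known S (W i)) :
    Comp S ((6 * wα + 20 * wβ) * t)
      (⋃ i, coefs (∑ k, U k * evenAntidiag g n (V k) (W i))) := by
  have h1 := h.rect 2 wα 1 (I := Fin (2 * n)) (K := Fin α) (J := Fin n) (S := S)
    (A := fun b k => blk g (U k) b) (B := fun k a => blk g (V k) (2 * a))
    (by simp) (by simpa) (by simp) (fun _ _ => blk_mem_degreeLT _ _ _)
    (fun _ _ => blk_mem_degreeLT _ _ _) (fun _ k => (kU k).blk _ _) (fun k _ => (kV k).blk _ _)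
  have hcost : ((2 : ℕ) : ℝ) * wα * (1 : ℕ) * (t + n ^ 2 * (2 * g)) +
      ((4 : ℕ) * (1 : ℕ) * wβ * (t + n ^ 2 * (2 * g)) +
        Fintype.card (Fin β) *
          ((Finset.univ : Finset (Fin (2 * n) × Fin 2)).card * (2 * g : ℕ))) ≤
      (6 * wα + 20 * wβ) * t := by
    have e1 : (wα : ℝ) * (n ^ 2 * g) ≤ wα * t := by gcongr
    have e2 : (β : ℝ) * (n * g) ≤ wβ * n * (n * g) := by
      have : (β : ℝ) ≤ wβ * n := by exact_mod_cast hβ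
      gcongr
    have e3 : (wβ : ℝ) * (n ^ 2 * g) ≤ wβ * t := by gcongr
    simp only [Fintype.card_fin, Finset.card_univ, Fintype.card_prod]
    push_cast
    linarith
  refine (h1.bind fun S₁ hS₁ hT₁ => ?_).mono_cost hcost
  -- The entries of `G` have up to `2g` coefficients and are split again into two blocks, which
  -- doubles the number of rows in the second product.
  set G : Fin (2 * n) → Fin n → (Ω → F)[X] :=
    fun b a => ∑ k, blk g (U k) b * blk g (V k) (2 * a) with hG
  have hGdeg : ∀ b a, G b a ∈ degreeLT _ (2 * g) := fun b a =>
    Submodule.sum_mem _ fun k _ => degreeLT_mul_mem (blk_mem_degreeLT _ _ _)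
      (blk_mem_degreeLT _ _ _) (by omega)
  refine (h.rect 4 1 wβ (I := Fin (2 * n) × Fin 2) (K := Fin n) (J := Fin β) (S := S₁)
    (A := fun x a => blk g (G x.1 a) x.2) (B := fun a i => blk g (W i) (2 * (n - 1 - a)))
    (by simp; omega) (by simp) (by simpa) (fun _ _ => blk_mem_degreeLT _ _ _)
    (fun _ _ => blk_mem_degreeLT _ _ _)
    (fun x a => (iUnion_coefs_subset.1 hT₁ (x.1, a)).blk _ _)
    (fun _ i => ((kW i).mono hS₁).blk _ _)).bind fun S₂ hS₂ hT₂ => ?_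
  have h3 := Comp.iUnion (S := S₂) fun i : Fin β => Comp.sum_X_pow_mul (e := 2 * g)
    (Finset.univ : Finset (Fin (2 * n) × Fin 2)) (fun x => x.1 * g + x.2 * g)
    (f := fun x => ∑ a : Fin n, blk g (G x.1 a) x.2 * blk g (W i) (2 * (n - 1 - a)))
    (fun b _ => Submodule.sum_mem _ fun k _ => degreeLT_mul_mem (blk_mem_degreeLT _ _ _)
      (blk_mem_degreeLT _ _ _) (by omega))
    fun x _ => iUnion_coefs_subset.1 hT₂ (x, i)
  convert h3 using 4 with i
  have hG2 : ∀ b a, ∑ e : Fin 2, X ^ (e * g : ℕ) * blk g (G b a) e = G b a := fun b a => by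
    rw [← Finset.sum_range (f := fun e => X ^ (e * g) * blk g (G b a) e),
      sum_X_pow_mul_blk (hGdeg b a)]
  calc ∑ k, U k * evenAntidiag g n (V k) (W i)
      = ∑ b : Fin (2 * n), X ^ (b * g : ℕ) *
          ∑ a : Fin n, G b a * blk g (W i) (2 * (n - 1 - a)) := by
        simp only [hG, Finset.sum_mul, Finset.mul_sum, evenAntidiag]
        have hUk : ∀ k, U k = ∑ b : Fin (2 * n), X ^ (b * g : ℕ) * blk g (U k) b := fun k => by
          rw [← Finset.sum_range (f := fun b => X ^ (b * g) * blk g (U k) b),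
            sum_X_pow_mul_blk (hU k)]
        calc _ = ∑ k, ∑ b : Fin (2 * n), ∑ a : Fin n, X ^ (b * g : ℕ) *
              (blk g (U k) b * blk g (V k) (2 * a) * blk g (W i) (2 * (n - 1 - a))) := by
              refine Finset.sum_congr rfl fun k _ => ?_
              rw [Finset.sum_range, Finset.sum_comm]
              refine Finset.sum_congr rfl fun a _ => ?_
              conv_lhs => rw [hUk k]
              rw [Finset.sum_mul]
              exact Finset.sum_congr rfl fun b _ => by ring
          _ = _ := by
              rw [Finset.sum_comm]
              exact Finset.sum_congr rfl fun b _ => Finset.sum_comm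
    _ = _ := by
        rw [Fintype.sum_prod_type]
        refine Finset.sum_congr rfl fun b _ => ?_
        simp only [pow_add, mul_assoc]
        rw [← Finset.mul_sum]
        congr 1
        simp only [Finset.mul_sum]
        rw [Finset.sum_comm]
        refine Finset.sum_congr rfl fun a _ => ?_
        conv_lhs => rw [← hG2 b a]
        simp only [Finset.sum_mul, mul_assoc]

/-- Induction along the doubling identity, from blocks of size `h` up to a single block. Halving the
matrices multiplies the numbers of square blocks by `2^k`, whence the weight `2^j` of `t j`; the 30
is `6 + 20` for the even part and 4 for the additions. -/
theorem comp_sum_mul_truncAntidiag_two_pow {L h : ℕ} {t : ℕ → ℝ}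
    (hmat : ∀ k ≤ L, MatLe F Ω (2 ^ (L - k)) (2 ^ k * h) (t k))
    (ht : ∀ k ≤ L, (((2 ^ (L - k) : ℕ) : ℝ)) ^ 2 * (2 ^ k * h : ℕ) ≤ t k)
    {α β ρα ρβ : ℕ} (hα : α ≤ ρα * 2 ^ L) (hβ : β ≤ ρβ * 2 ^ L) {ρ : ℝ} (h₁ : ρα ≤ ρ)
    (h₂ : ρβ ≤ ρ) (h₃ : (ρα : ℝ) * ρβ ≤ ρ)
    {S : Set (Ω → F)} {U V : Fin α → (Ω → F)[X]} {W : Fin β → (Ω → F)[X]}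
    (hU : ∀ k, U k ∈ degreeLT _ (2 * 2 ^ L * h)) (kU : ∀ k, Known S (U k))
    (kV : ∀ k, Known S (V k)) (kW : ∀ i, Known S (W i)) (k : ℕ) (hk : k ≤ L + 1) :
    Comp S (16 * ρ * t 0 + ∑ j ∈ Finset.range k, 30 * ρ * (2 ^ j * t j))
      (⋃ i, coefs (∑ l, U l * truncAntidiag (2 ^ k * h) (2 ^ (L + 1 - k)) (V l) (W i))) := by
  induction k with
  | zero =>
    have hm := hmat 0 (Nat.zero_le _)
    have ht0 := ht 0 (Nat.zero_le _)
    simp only [pow_zero, one_mul, Nat.sub_zero] at hm ht0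
    have := comp_sum_mul_truncAntidiag hm ht0 hα hβ hU kU kV kW
    rw [← pow_succ'] at this
    have ht0' : 0 ≤ t 0 := le_trans (by positivity) ht0
    simp only [pow_zero, one_mul, Nat.sub_zero, Finset.range_zero, Finset.sum_empty, add_zero]
    refine this.mono_cost (mul_le_mul_of_nonneg_right (by linarith) ht0')
  | succ k ih =>
    have hk' : k ≤ L := by omega
    have hg : 2 ^ L = 2 ^ (L - k) * 2 ^ k := by rw [← pow_add]; congr 1; omega
    have htk := ht k hk'
    have htk' : 0 ≤ t k := le_trans (by positivity) htk
    have hU' : ∀ l, U l ∈ degreeLT _ (2 * 2 ^ (L - k) * (2 ^ k * h)) := fun l => by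
      convert hU l using 2
      rw [hg]
      ring
    have heven := comp_sum_mul_evenAntidiag (hmat k hk') htk (wα := ρα * 2 ^ k)
      (wβ := ρβ * 2 ^ k) (by rw [mul_assoc, mul_comm (2 ^ k), ← hg]; exact hα)
      (by rw [mul_assoc, mul_comm (2 ^ k), ← hg]; exact hβ) hU' kU kV kW
    rw [Finset.sum_range_succ, ← add_assoc]
    have hcost : ((6 * (ρα * 2 ^ k : ℕ) + 20 * (ρβ * 2 ^ k : ℕ)) * t k +
        Fintype.card (Fin β) * (4 * 2 ^ L * h : ℕ) : ℝ) ≤ 30 * ρ * (2 ^ k * t k) := by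
      have e1 : (β : ℝ) * (2 ^ L * h) ≤ ρβ * 2 ^ L * (2 ^ L * h) := by
        have : (β : ℝ) ≤ ρβ * 2 ^ L := by exact_mod_cast hβ
        gcongr
      have e2 : (ρβ : ℝ) * 2 ^ L * (2 ^ L * h) ≤ ρβ * 2 ^ k * t k := by
        have hg' : (2 : ℝ) ^ L = 2 ^ (L - k) * 2 ^ k := by exact_mod_cast hg
        calc (ρβ : ℝ) * 2 ^ L * (2 ^ L * h)
            = ρβ * 2 ^ k * ((((2 ^ (L - k) : ℕ) : ℝ)) ^ 2 * (2 ^ k * h : ℕ)) := by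
              rw [hg']; push_cast; ring
          _ ≤ _ := by gcongr
      have e3 : (ρα : ℝ) * (2 ^ k * t k) ≤ ρ * (2 ^ k * t k) := by gcongr
      have e4 : (ρβ : ℝ) * (2 ^ k * t k) ≤ ρ * (2 ^ k * t k) := by gcongr
      simp only [Fintype.card_fin]
      push_cast
      linarith
    refine Comp.mono_cost (Comp.bind (ih (by omega)) fun S₁ hS₁ hT₁ =>
      Comp.bind (heven.mono_left (hS₁.trans (subset_withConsts _))) fun S₂ hS₂ hT₂ => ?_)
      (add_le_add le_rfl hcost)
    refine Comp.iUnion fun i => ?_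
    have hpow : 2 ^ (L + 1 - k) = 2 * 2 ^ (L - k) := by
      rw [← pow_succ']; congr 1; omega
    have := Comp.add_X_pow_mul (S := S₂) (2 ^ k * h) (e := 4 * 2 ^ L * h)
      (f := ∑ l, U l * truncAntidiag (2 ^ k * h) (2 ^ (L + 1 - k)) (V l) (W i))
      (Submodule.sum_mem _ fun l _ => degreeLT_mul_mem (hU l)
        (truncAntidiag_mem_degreeLT _ _ _ _) ?_) ((iUnion_coefs_subset.1 hT₁ i).mono hS₂)
      (iUnion_coefs_subset.1 hT₂ i)
    · convert this using 2
      rw [Finset.mul_sum, ← Finset.sum_add_distrib]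
      refine Finset.sum_congr rfl fun l _ => ?_
      rw [show L + 1 - (k + 1) = L - k by omega, pow_succ', mul_assoc, truncAntidiag_two_mul, hpow]
      ring
    · have : 2 ^ k * h ≤ 2 ^ L * h :=
        Nat.mul_le_mul_right _ (Nat.pow_le_pow_right two_pos hk')
      nlinarith [Nat.zero_le (2 ^ L * h)]

end Antidiagonal

/-! ### From remainders modulo `Q` to truncated products, and the total cost -/

section Reduction

variable {F Ω : Type*} [Field F]

theorem Known.of_eq_add_X_pow_mul {S : Set (Ω → F)} {f r q : (Ω → F)[X]} {e : ℕ}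
    (hf : Known S f) (h : f = r + X ^ e * q) (hr : r ∈ degreeLT _ e) : Known S q :=
  hf.of_coeff fun s => .inr ⟨s + e, by
    rw [h, coeff_add, coeff_X_pow_mul, mem_degreeLT_iff_coeff.1 hr _ (Nat.le_add_left e s),
      zero_add]⟩

/-- The sum of the products modulo `Q` reduces to sums of products modulo a power of `X`. -/
theorem IsMulTime.comp_sum_mul_modByMonic [Nonempty Ω] {M : ℕ → ℝ} (hM : IsMulTime F M)
    {m n p P α β : ℕ} (hn : 0 < n) (hmp : m ≤ p) (hnp : n ≤ p) (hpP : p ≤ P) (hP : P < 4 * p)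
    {S : Set (Ω → F)} {Q : (Ω → F)[X]} {U V : Fin α → (Ω → F)[X]} {W : Fin β → (Ω → F)[X]}
    (hQ : Q.Monic) (hQn : Q.natDegree = n) (hU : ∀ k, U k ∈ degreeLT _ m)
    (hV : ∀ k, V k ∈ degreeLT _ n) (hW : ∀ i, W i ∈ degreeLT _ n) (kQ : Known S Q)
    (kU : ∀ k, Known S (U k)) (kV : ∀ k, Known S (V k)) (kW : ∀ i, Known S (W i)) {τ : ℝ}
    (hτ : ∀ (S' : Set (Ω → F)) (W' : Fin β → (Ω → F)[X]), S ⊆ S' → (∀ i, W' i ∈ degreeLT _ P) →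
      (∀ i, Known S' (W' i)) → Comp S' τ (⋃ i, coefs (∑ k, U k * blk P (V k * W' i) 0))) :
    Comp S ((138 + 50 * α + 201 * β) * M p + τ)
      (⋃ i, coefs (∑ k, U k * ((V k * W i) %ₘ Q))) := by
  have hp : 0 < p := by omega
  have hMp := hM.le hp
  have hmul : MulLe F Ω (4 * p) (48 * M p) := fun S f g hf hg kf kg =>
    ((hM.mulLe hp).blocks 4 S f g hf hg kf kg).mono_cost (by push_cast; linarith)
  have hQdeg : Q ∈ degreeLT (Ω → F) (n + 1) := by
    rw [mem_degreeLT_iff_coeff]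
    exact fun s hs => coeff_eq_zero_of_natDegree_lt (by omega)
  have hG : (reflect n Q).coeff 0 = 1 := by
    rw [coeff_reflect, revAt_le (Nat.zero_le _), Nat.sub_zero, ← hQn]
    exact hQ
  obtain ⟨Y, -, hYd, hYc⟩ := hM.exists_inverse_four_mul hG p hp
  -- `J` is the polynomial part of `X^(n+P) / Q`. It needs precision `P + 1`, which `4 * p` covers
  -- because `P < 4 * p`.
  set J := reflect P (blk (P + 1) Y 0) with hJ
  have hJdeg : J ∈ degreeLT (Ω → F) (P + 1) := by
    rw [mem_degreeLT_iff_coeff]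
    intro s hs
    rw [hJ, coeff_reflect, revAt_eq_self_of_lt (by omega), coeff_blk, if_neg (by omega)]
  have hr : X ^ (n + P) - J * Q ∈ degreeLT (Ω → F) n := by
    refine X_pow_sub_reflect_mul_mem_degreeLT hQdeg (blk_mem_degreeLT _ _ _) ?_
    obtain ⟨q, hq⟩ := exists_eq_blk_zero_add (P + 1) Y
    have h1 : X ^ (P + 1) ∣ reflect n Q * Y - 1 :=
      (pow_dvd_pow X (by omega : P + 1 ≤ 4 * p)).trans hYd
    have h2 : reflect n Q * blk (P + 1) Y 0 - 1 =
        (reflect n Q * Y - 1) - X ^ (P + 1) * (reflect n Q * q) := by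
      linear_combination (-reflect n Q) * hq
    rw [h2]
    exact dvd_sub h1 (dvd_mul_right _ _)
  choose W' hW' using fun i => exists_eq_blk_zero_add n (W i * J)
  have hW'deg : ∀ i, W' i ∈ degreeLT (Ω → F) P := fun i => by
    refine mem_degreeLT_of_X_pow_mul (e := n) ?_
    rw [← sub_eq_of_eq_add' (hW' i)]
    exact sub_mem (degreeLT_mul_mem (hW i) hJdeg (by omega))
      (degreeLT_mono' (blk_mem_degreeLT _ _ _) (by omega))
  -- `W' i` approximates `X^P * W i / Q` closely enough for the remainder to have degree less than
  -- `n`.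
  have hr' : ∀ i, X ^ P * W i - W' i * Q ∈ degreeLT (Ω → F) n := fun i =>
    sub_mul_mem_degreeLT_of_approx (A := W i) (e := n) (B := X ^ (n + P)) (I := J)
      (t := blk n (W i * J) 0) hQdeg (degreeLT_mono' (hW i) (by omega)) hr
      (blk_mem_degreeLT _ _ _) (by ring) (by rw [add_comm]; exact hW' i) (by ring)
  choose s hs using fun k i => exists_eq_blk_zero_add P (V k * W' i)
  have hsdeg : ∀ k i, s k i ∈ degreeLT (Ω → F) n := fun k i => by
    refine mem_degreeLT_of_X_pow_mul (e := P) ?_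
    rw [← sub_eq_of_eq_add' (hs k i)]
    exact sub_mem (degreeLT_mul_mem (hV k) (hW'deg i) (by omega))
      (degreeLT_mono' (blk_mem_degreeLT _ _ _) (by omega))
  -- The same approximation argument, now with `V k` and `W' i`, shows that `s k i` is the true
  -- quotient of `V k * W i` by `Q`.
  have hrem : ∀ k i, V k * W i - s k i * Q ∈ degreeLT (Ω → F) n := fun k i =>
    sub_mul_mem_degreeLT_of_approx (A := V k) (e := P) (B := X ^ P * W i) (I := W' i)
      (t := blk P (V k * W' i) 0) hQdeg
      (degreeLT_mono' (hV k) (by omega)) (hr' i)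
      (blk_mem_degreeLT _ _ _) (by ring) (by rw [add_comm]; exact hs k i) (by ring)
  have hmod : ∀ k i, (V k * W i) %ₘ Q = V k * W i - s k i * Q := fun k i => by
    refine (div_modByMonic_unique (s k i) _ hQ ⟨by ring, ?_⟩).2
    rw [degree_eq_natDegree hQ.ne_zero, hQn]
    exact mem_degreeLT.1 (hrem k i)
  set Z := ∑ k, U k * V k with hZ
  set T := fun i => ∑ k, U k * blk P (V k * W' i) 0 with hT
  set E := fun i => ∑ k, U k * s k i with hE
  have hUVdeg : ∀ k, U k * V k ∈ degreeLT (Ω → F) (2 * p) := fun k =>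
    degreeLT_mul_mem (hU k) (hV k) (by omega)
  have hZdeg : Z ∈ degreeLT (Ω → F) (4 * p) := Submodule.sum_mem _ fun k _ =>
    degreeLT_mono' (hUVdeg k) (by omega)
  have hTdeg : ∀ i, T i ∈ degreeLT (Ω → F) (5 * p) := fun i => Submodule.sum_mem _ fun k _ =>
    degreeLT_mul_mem (hU k) (blk_mem_degreeLT _ _ _) (by omega)
  have hEdeg : ∀ i, E i ∈ degreeLT (Ω → F) (2 * p) := fun i => Submodule.sum_mem _ fun k _ =>
    degreeLT_mul_mem (hU k) (hsdeg k i) (by omega)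
  have hquot : ∀ i, Z * W' i - T i = X ^ P * E i := fun i => by
    simp only [hZ, hT, hE, Finset.sum_mul, Finset.mul_sum]
    rw [← Finset.sum_sub_distrib]
    exact Finset.sum_congr rfl fun k _ => by linear_combination U k * hs k i
  have hres : ∀ i, ∑ k, U k * ((V k * W i) %ₘ Q) = Z * W i - E i * Q := fun i => by
    simp only [hZ, hE, hmod, Finset.sum_mul]
    rw [← Finset.sum_sub_distrib]
    exact Finset.sum_congr rfl fun k _ => by ring
  simp only [hres]
  have hcost : 138 * M p + (Fintype.card (Fin β) * (48 * M p) +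
      (Fintype.card (Fin α) * (48 * M p) + ((Finset.univ : Finset (Fin α)).card * (2 * p : ℕ) +
      (Fintype.card (Fin β) * (48 * M p) + (τ + (Fintype.card (Fin β) * (5 * p : ℕ) +
      (Fintype.card (Fin β) * (48 * M p) + (Fintype.card (Fin β) * (48 * M p) +
      Fintype.card (Fin β) * (4 * p : ℕ))))))))) ≤ (138 + 50 * α + 201 * β) * M p + τ := by
    have e1 : (α : ℝ) * p ≤ α * M p := by gcongr
    have e2 : (β : ℝ) * p ≤ β * M p := by gcongr
    simp only [Fintype.card_fin, Finset.card_univ]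
    push_cast
    linarith
  refine Comp.mono_cost ?_ hcost
  refine (hYc S (kQ.reflect n)).bind fun S₁ h₁ hT₁ => ?_
  have kJ : Known S₁ J := ((coefs_subset.1 hT₁).blk _ _).reflect _
  refine (Comp.iUnion fun i => hmul S₁ (W i) J (degreeLT_mono' (hW i) (by omega))
    (degreeLT_mono' hJdeg (by omega)) ((kW i).mono h₁) kJ).bind fun S₂ h₂ hT₂ => ?_
  have kW' : ∀ i, Known S₂ (W' i) := fun i =>
    (iUnion_coefs_subset.1 hT₂ i).of_eq_add_X_pow_mul (hW' i) (blk_mem_degreeLT _ _ _)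
  replace h₂ := h₁.trans h₂
  refine (Comp.iUnion fun k => hmul S₂ (U k) (V k) (degreeLT_mono' (hU k) (by omega))
    (degreeLT_mono' (hV k) (by omega)) ((kU k).mono h₂) ((kV k).mono h₂)).bind fun S₃ h₃ hT₃ => ?_
  refine (Comp.sum Finset.univ (fun k _ => hUVdeg k)
    fun k _ => iUnion_coefs_subset.1 hT₃ k).bind fun S₄ h₄ hT₄ => ?_
  replace kW' := fun i => ((kW' i).mono h₃).mono h₄
  replace h₄ := (h₂.trans h₃).trans h₄
  have kZ : Known S₄ Z := coefs_subset.1 hT₄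
  refine (Comp.iUnion fun i => hmul S₄ Z (W' i) hZdeg (degreeLT_mono' (hW'deg i) (by omega)) kZ
    (kW' i)).bind fun S₅ h₅ hT₅ => ?_
  refine (hτ S₅ W' (h₄.trans h₅) hW'deg fun i => (kW' i).mono h₅).bind fun S₆ h₆ hT₆ => ?_
  refine (Comp.iUnion fun i => Comp.sub (hTdeg i) ((iUnion_coefs_subset.1 hT₅ i).mono h₆)
    (iUnion_coefs_subset.1 hT₆ i)).bind fun S₇ h₇ hT₇ => ?_
  -- Division by `X^P` only shifts coefficients, so it costs nothing.
  have kE : ∀ i, Known S₇ (E i) := fun i =>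
    Known.of_X_pow_mul (hquot i ▸ iUnion_coefs_subset.1 hT₇ i)
  replace h₇ := (h₅.trans h₆).trans h₇
  refine (Comp.iUnion fun i => hmul S₇ (E i) Q (degreeLT_mono' (hEdeg i) (by omega))
    (degreeLT_mono' hQdeg (by omega)) (kE i) (kQ.mono (h₄.trans h₇))).bind fun S₈ h₈ hT₈ => ?_
  replace h₈ := h₇.trans h₈
  refine (Comp.iUnion fun i => hmul S₈ Z (W i) hZdeg (degreeLT_mono' (hW i) (by omega))
    (kZ.mono h₈) ((kW i).mono (h₄.trans h₈))).bind fun S₉ h₉ hT₉ => ?_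
  exact Comp.iUnion fun i => Comp.sub (degreeLT_mul_mem (hEdeg i) hQdeg (by omega))
    (iUnion_coefs_subset.1 hT₉ i) ((iUnion_coefs_subset.1 hT₈ i).mono h₉)

/-- The smaller of `α` and `β` needs at most 2 blocks of size `N`, the larger at most `max / min + 1
≤ 2 max / min`; so even the product is linear in `max / min`. -/
theorem sum_modByMonic_cost_bound {α β N : ℕ} (hα : 0 < α) (hβ : 0 < β) (hN : min α β ≤ N) :
    ((α / N + 1 : ℕ) : ℝ) ≤ 4 * ((max α β : ℕ) / (min α β : ℕ)) ∧
      ((β / N + 1 : ℕ) : ℝ) ≤ 4 * ((max α β : ℕ) / (min α β : ℕ)) ∧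
      ((α / N + 1 : ℕ) : ℝ) * (β / N + 1 : ℕ) ≤ 4 * ((max α β : ℕ) / (min α β : ℕ)) := by
  have key : ∀ a b : ℕ, 0 < a → a ≤ b → a ≤ N → ((a / N + 1 : ℕ) : ℝ) ≤ 2 ∧
      ((b / N + 1 : ℕ) : ℝ) ≤ 2 * (b / a) ∧ (1 : ℝ) ≤ b / a := by
    intro a b ha hab haN
    have ha' : (0 : ℝ) < a := by exact_mod_cast ha
    have h1 : (1 : ℝ) ≤ b / a := by
      rw [one_le_div ha']
      exact_mod_cast hab
    refine ⟨?_, ?_, h1⟩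
    · have : a / N ≤ 1 := Nat.div_le_of_le_mul (by omega)
      exact_mod_cast Nat.succ_le_succ this
    · have h2 : ((b / N : ℕ) : ℝ) ≤ b / N := Nat.cast_div_le
      have h3 : (b : ℝ) / N ≤ b / a := by gcongr
      push_cast
      linarith
  rcases le_total α β with h | h
  · rw [min_eq_left h] at *
    rw [max_eq_right h]
    obtain ⟨h1, h2, h3⟩ := key α β hα h hN
    refine ⟨by linarith, by linarith, ?_⟩
    calc _ ≤ 2 * (2 * ((β : ℝ) / α)) := by gcongr
      _ = _ := by ring
  · rw [min_eq_right h] at *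
    rw [max_eq_left h]
    obtain ⟨h1, h2, h3⟩ := key β α hβ h hN
    refine ⟨by linarith, by linarith, ?_⟩
    calc _ ≤ (2 * ((α : ℝ) / β)) * 2 := by gcongr
      _ = _ := by ring

theorem comp_sum_mul_modByMonic [Nonempty Ω] {M : ℕ → ℝ} (hM : IsMulTime F M)
    {Mmat : ℝ → ℕ → ℝ} (hMmat : IsMatMulTime F Mmat) {c : ℝ}
    (hc : ∀ d : ℝ, 1 ≤ d → M ⌈d⌉₊ ≤ c * Mmat d 1) {m n α β : ℕ} (hα : 0 < α)
    (hβ : 0 < β) (hαn : α ≤ n) {S : Set (Ω → F)} {Q : (Ω → F)[X]} {U V : Fin α → (Ω → F)[X]}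
    {W : Fin β → (Ω → F)[X]} (hQ : Q.Monic) (hQn : Q.natDegree = n)
    (hU : ∀ k, U k ∈ degreeLT _ m) (hV : ∀ k, V k ∈ degreeLT _ n) (hW : ∀ i, W i ∈ degreeLT _ n)
    (kQ : Known S Q) (kU : ∀ k, Known S (U k)) (kV : ∀ k, Known S (V k))
    (kW : ∀ i, Known S (W i)) :
    Comp S ((389 * |c| + 184) * (((max α β : ℕ) : ℝ) / ((min α β : ℕ) : ℝ) *
        MmatPrime Mmat (((max m n : ℕ) : ℝ) / ((min α β : ℕ) : ℝ)) (min α β)))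
      (⋃ i, coefs (∑ k, U k * ((V k * W i) %ₘ Q))) := by
  have hmin : 0 < min α β := lt_min hα hβ
  have hminp : min α β ≤ max m n := (min_le_left _ _).trans (hαn.trans (le_max_right _ _))
  have hmp : m ≤ max m n := le_max_left _ _
  have hnp : n ≤ max m n := le_max_right _ _
  obtain ⟨r₁, r₂, r₃⟩ := sum_modByMonic_cost_bound hα hβ (Nat.le_pow_clog one_lt_two (min α β))
  have hαr : α ≤ max α β := le_max_left _ _
  have hβr : β ≤ max α β := le_max_right _ _
  generalize max m n = p at *
  generalize max α β = b at *
  generalize min α β = a at *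
  have ha : (0 : ℝ) < a := by exact_mod_cast hmin
  set d : ℝ := p / a with hd
  have hd1 : 1 ≤ d := by
    rw [hd, one_le_div ha]
    exact_mod_cast hminp
  have hk1 : ∀ k : ℕ, 1 ≤ 2 ^ k * d := fun k =>
    one_le_mul_of_one_le_of_one_le (one_le_pow₀ one_le_two) hd1
  set L := Nat.clog 2 a with hL
  have haL : a ≤ 2 ^ L := Nat.le_pow_clog one_lt_two a
  have hLa : 2 ^ L < 2 * a := by
    rcases Nat.lt_or_ge 1 a with h | h
    · have h1 := Nat.pow_pred_clog_lt_self one_lt_two h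
      have h2 : 0 < L := Nat.clog_pos one_lt_two h
      have h3 : 2 ^ L = 2 * 2 ^ (L - 1) := by rw [← pow_succ']; congr 1; omega
      rw [h3]
      exact Nat.mul_lt_mul_of_pos_left h1 two_pos
    · obtain rfl : a = 1 := by omega
      simp [hL]
  -- Rounding down guarantees `2^k * h ≤ ⌈2^k * d⌉₊` at every level. The lost factor of at most 2 is
  -- made up by the 2 in `P`, which keeps `p ≤ P < 4 * p`.
  set h := p / a with hh
  have hhpos : 0 < h := Nat.div_pos hminp hmin
  have hhp : a * h ≤ p := Nat.mul_div_le p a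
  have hph : p < a * h + a := Nat.lt_mul_div_succ p hmin |>.trans_eq (by ring)
  set P := 2 * 2 ^ L * h with hPdef
  have hpP : p ≤ P := by
    have h1 : a * h ≤ 2 ^ L * h := Nat.mul_le_mul_right _ haL
    have h2 : a ≤ a * h := Nat.le_mul_of_pos_right _ hhpos
    rw [hPdef]
    linarith
  have hP4 : P < 4 * p := by
    have h1 : 2 ^ L * h < 2 * a * h := Nat.mul_lt_mul_of_pos_right hLa hhpos
    rw [hPdef]
    linarith
  have hhd : (h : ℝ) ≤ d := Nat.cast_div_le
  set t : ℕ → ℝ := fun k => Mmat (2 ^ k * d) (2 ^ (L - k)) with ht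
  have hD : ∀ k, 2 ^ k * h ≤ ⌈2 ^ k * d⌉₊ := fun k => by
    have h1 : ((2 ^ k * h : ℕ) : ℝ) ≤ 2 ^ k * d := by
      push_cast
      gcongr
    exact_mod_cast h1.trans (Nat.le_ceil _)
  have hmat : ∀ k ≤ L, MatLe F Ω (2 ^ (L - k)) (2 ^ k * h) (t k) := fun k _ =>
    (hMmat.matLe (hk1 k) (by positivity)).mono (hD k)
  have htk : ∀ k ≤ L, (((2 ^ (L - k) : ℕ) : ℝ)) ^ 2 * (2 ^ k * h : ℕ) ≤ t k := fun k _ => by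
    refine le_trans ?_ (hMmat.le (hk1 k) (by positivity))
    gcongr
    exact hD k
  have ht0 : ∀ k, 0 ≤ t k := fun k =>
    le_trans (by positivity) (hMmat.le (hk1 k) (by positivity))
  have hM' : MmatPrime Mmat d a = ∑ k ∈ Finset.range (L + 1), 2 ^ k * t k := by
    rw [MmatPrime, nextPowTwo, Nat.log_pow one_lt_two]
    refine Finset.sum_congr rfl fun k hk => ?_
    rw [Nat.pow_div (by have := Finset.mem_range.1 hk; omega) two_pos]
  have hterm : ∀ k ≤ L, 2 ^ k * t k ≤ MmatPrime Mmat d a := fun k hk => by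
    rw [hM']
    exact Finset.single_le_sum (f := fun k => 2 ^ k * t k)
      (fun k _ => mul_nonneg (by positivity) (ht0 k)) (Finset.mem_range.2 (by omega))
  -- The last summand of `MmatPrime` is `2^L` times the time for `1 × 1` matrices of degree `2^L * d
  -- ≥ p`, which dominates `M p` by hypothesis. The absolute value is there because `c` has no
  -- assumed sign.
  have hMp : a * M p ≤ |c| * MmatPrime Mmat d a := by
    have hp : 0 < p := by omega
    have hpq : p ≤ ⌈2 ^ L * d⌉₊ := by
      have h1 : (p : ℝ) ≤ 2 ^ L * d := by
        calc (p : ℝ) = a * d := by rw [hd]; field_simp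
          _ ≤ _ := by
            gcongr
            exact_mod_cast haL
      exact_mod_cast h1.trans (Nat.le_ceil _)
    have h1 := hM.superlinear p _ hp hpq
    have h2 := hc _ (hk1 L)
    have hp' : (0 : ℝ) < p := by exact_mod_cast hp
    have hq : (p : ℝ) ≤ ⌈2 ^ L * d⌉₊ := by exact_mod_cast hpq
    have h3 := hM.le (hp.trans_le hpq)
    have h0 := hM.le hp
    have h4 : M p ≤ M ⌈2 ^ L * d⌉₊ := by
      rw [div_le_div_iff₀ hp' (hp'.trans_le hq)] at h1
      have : M p * p ≤ M p * ⌈2 ^ L * d⌉₊ := by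
        have := hp'.le.trans h0
        gcongr
      exact le_of_mul_le_mul_right (this.trans h1) hp'
    have h5 : c * Mmat (2 ^ L * d) 1 ≤ |c| * t L := by
      have h6 : t L = Mmat (2 ^ L * d) 1 := by simp [ht]
      rw [← h6]
      exact mul_le_mul_of_nonneg_right (le_abs_self c) (ht0 L)
    calc (a : ℝ) * M p ≤ 2 ^ L * (|c| * t L) := by
          have := hp'.le.trans h0
          have h7 : (a : ℝ) ≤ 2 ^ L := by exact_mod_cast haL
          have h8 : M p ≤ |c| * t L := by linarith
          gcongr
      _ = |c| * (2 ^ L * t L) := by ring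
      _ ≤ _ := by
          have := hterm L le_rfl
          gcongr
  -- The 4 is that of `sum_modByMonic_cost_bound`. The block products cost `16 + 30 = 46` times `ρ`,
  -- giving `184 = 4 * 46`; and `389 = 138 + 50 + 201` since `1`, `α` and `β` are at most `b`.
  set ρ : ℝ := 4 * (b / a) with hρ
  have hdiv : ∀ x : ℕ, x ≤ (x / 2 ^ L + 1) * 2 ^ L := fun x => by
    rw [mul_comm]
    exact (Nat.lt_mul_div_succ x (by positivity)).le
  have hcomp := hM.comp_sum_mul_modByMonic (τ := 46 * ρ * MmatPrime Mmat d a) (S := S)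
    (hα.trans_le hαn) hmp hnp hpP hP4 hQ hQn hU hV hW kQ kU kV kW ?_
  · refine hcomp.mono_cost ?_
    have hb1 : (1 : ℝ) ≤ b := by exact_mod_cast hα.trans_le hαr
    have hα' : (α : ℝ) ≤ b := by exact_mod_cast hαr
    have hβ' : (β : ℝ) ≤ b := by exact_mod_cast hβr
    have hM0 : 0 ≤ M p := (Nat.cast_nonneg p).trans (hM.le (by omega))
    have e1 : (138 + 50 * (α : ℝ) + 201 * β) * M p ≤ 389 * b * M p := by
      gcongr
      linarith
    have e2 : b * M p ≤ b / a * (|c| * MmatPrime Mmat d a) := by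
      calc b * M p = b / a * (a * M p) := by field_simp
        _ ≤ _ := by gcongr
    rw [hρ]
    linarith
  · intro S' W' hS hW' kW'
    have := comp_sum_mul_truncAntidiag_two_pow hmat htk (hdiv α) (hdiv β) (ρ := ρ) r₁ r₂ r₃
      (S := S') (U := U) (V := V) (W := W') (fun k => degreeLT_mono' (hU k) (hmp.trans hpP))
      (fun k => (kU k).mono hS) (fun k => (kV k).mono hS) kW' (L + 1) le_rfl
    rw [Nat.sub_self, pow_zero, pow_succ', ← hPdef] at this
    simp only [fun k i => truncAntidiag_one (degreeLT_mono' (hV k) (hnp.trans hpP)) (hW' i)] at this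
    refine this.mono_cost ?_
    rw [← Finset.mul_sum, ← hM']
    have h1 := hterm 0 (Nat.zero_le _)
    rw [pow_zero, one_mul] at h1
    have h2 : 0 ≤ ρ := by positivity
    nlinarith [mul_le_mul_of_nonneg_left h1 h2]

end Reduction

/-! ### The generic instance over the functions on all admissible inputs -/

section Families

variable {F Ω : Type*} [Field F]

/-- The polynomial over the functions on `Ω` whose values are the members of a family of
polynomials with `e` coefficients. -/
noncomputable def gather (e : ℕ) (f : Ω → F[X]) : (Ω → F)[X] :=
  ∑ s ∈ Finset.range e, monomial s fun ω => (f ω).coeff s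

theorem coeff_gather (e : ℕ) (f : Ω → F[X]) (s : ℕ) :
    (gather e f).coeff s = if s < e then fun ω => (f ω).coeff s else 0 := by
  simp [gather, coeff_monomial]

theorem gather_mem_degreeLT (e : ℕ) (f : Ω → F[X]) : gather e f ∈ degreeLT (Ω → F) e := by
  rw [mem_degreeLT_iff_coeff]
  intro s hs
  rw [coeff_gather, if_neg (by omega)]

theorem map_gather {e : ℕ} {f : Ω → F[X]} (hf : ∀ ω, f ω ∈ degreeLT F e) (ω : Ω) :
    (gather e f).map (Pi.evalRingHom (fun _ => F) ω) = f ω := by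
  ext s
  rw [coeff_map, coeff_gather]
  split_ifs with hs
  · rfl
  · simp [mem_degreeLT_iff_coeff.1 (hf ω) s (not_lt.1 hs)]

theorem known_gather {S : Set (Ω → F)} {e : ℕ} {f : Ω → F[X]}
    (h : ∀ s < e, (fun ω => (f ω).coeff s) ∈ withConsts S) : Known S (gather e f) := fun s => by
  rw [coeff_gather]
  split_ifs with hs
  exacts [h s hs, zero_mem_withConsts S]

end Families

theorem sumModProd_mem_degreeLT {F : Type*} [Field F] {m n α β : ℕ} (hn : 0 < n) {Q : F[X]}
    {U V : Fin α → F[X]} {W : Fin β → F[X]} (hQ : Q.Monic) (hQn : Q.natDegree = n)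
    (hU : ∀ k, U k ∈ degreeLT F m) (i : Fin β) :
    sumModProd Q U V W i ∈ degreeLT F (m + n - 1) := by
  refine Submodule.sum_mem _ fun k _ => degreeLT_mul_mem (hU k) (b := n) ?_ (by omega)
  rw [mem_degreeLT, ← hQn, ← degree_eq_natDegree hQ.ne_zero]
  exact degree_modByMonic_lt _ hQ

/-- The inputs for which the sums of products modulo `Q` have to be computed. -/
structure AdmissibleInput (F : Type*) [Field F] (m n α β : ℕ) where
  Q : F[X]
  U : Fin α → F[X]
  V : Fin α → F[X]
  W : Fin β → F[X]
  monic : Q.Monic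
  natDegree_eq : Q.natDegree = n
  U_mem : ∀ k, U k ∈ degreeLT F m
  V_mem : ∀ k, V k ∈ degreeLT F n
  W_mem : ∀ i, W i ∈ degreeLT F n

namespace AdmissibleInput

variable {F : Type*} [Field F] {m n α β : ℕ}

instance : Nonempty (AdmissibleInput F m n α β) :=
  ⟨⟨X ^ n, 0, 0, 0, monic_X_pow n, natDegree_X_pow n, fun _ => zero_mem _, fun _ => zero_mem _,
    fun _ => zero_mem _⟩⟩

/-- The input coefficients, as functions on the admissible inputs. -/
noncomputable def inputFun (i : ProblemInput m n α β) (ω : AdmissibleInput F m n α β) : F :=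
  problemInput m n ω.Q ω.U ω.V ω.W i

theorem inputFun_mem (i : ProblemInput m n α β) :
    inputFun (F := F) i ∈
      withConsts (Set.range (inputFun (F := F) (m := m) (n := n) (α := α) (β := β))) :=
  subset_withConsts _ ⟨i, rfl⟩

variable (F m n α β) in
/-- The generic monic polynomial of degree `n`. -/
noncomputable def genQ : (AdmissibleInput F m n α β → F)[X] := gather (n + 1) Q

variable (F m n β) in
/-- The generic first factors. -/
noncomputable def genU (k : Fin α) : (AdmissibleInput F m n α β → F)[X] := gather m fun ω => ω.U k

variable (F m n β) in
/-- The generic second factors. -/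
noncomputable def genV (k : Fin α) : (AdmissibleInput F m n α β → F)[X] := gather n fun ω => ω.V k

variable (F m n α) in
/-- The generic third factors. -/
noncomputable def genW (i : Fin β) : (AdmissibleInput F m n α β → F)[X] := gather n fun ω => ω.W i

theorem coeff_Q (ω : AdmissibleInput F m n α β) : ω.Q.coeff n = 1 := by
  have h := ω.monic
  rwa [Monic, leadingCoeff, ω.natDegree_eq] at h

theorem coeff_genQ : (genQ F m n α β).coeff n = 1 := by
  rw [genQ, coeff_gather, if_pos (Nat.lt_succ_self n)]
  exact funext coeff_Q

theorem natDegree_genQ_le : (genQ F m n α β).natDegree ≤ n := by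
  rw [natDegree_le_iff_coeff_eq_zero]
  intro s hs
  rw [genQ, coeff_gather, if_neg (by omega)]

theorem monic_genQ : (genQ F m n α β).Monic :=
  monic_of_natDegree_le_of_coeff_eq_one n natDegree_genQ_le coeff_genQ

theorem natDegree_genQ : (genQ F m n α β).natDegree = n :=
  natDegree_eq_of_le_of_coeff_ne_zero natDegree_genQ_le (by simp [coeff_genQ])

theorem known_genQ : Known (Set.range inputFun) (genQ F m n α β) :=
  known_gather fun s hs => by
    rcases Nat.lt_succ_iff_lt_or_eq.1 hs with hs | rfl
    · exact inputFun_mem (.inr (.inr (.inr ⟨s, hs⟩)))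
    -- The leading coefficient of `Q` is not an input, but it is the constant 1 and therefore free.
    · rw [show (fun ω : AdmissibleInput F m s α β => ω.Q.coeff s) = Function.const _ 1 from
        funext coeff_Q]
      exact const_mem_withConsts _ 1

theorem known_genU (k : Fin α) : Known (Set.range inputFun) (genU F m n β k) :=
  known_gather fun s hs => inputFun_mem (.inl (k, ⟨s, hs⟩))

theorem known_genV (k : Fin α) : Known (Set.range inputFun) (genV F m n β k) :=
  known_gather fun s hs => inputFun_mem (.inr (.inl (k, ⟨s, hs⟩)))

theorem known_genW (i : Fin β) : Known (Set.range inputFun) (genW F m n α i) :=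
  known_gather fun s hs => inputFun_mem (.inr (.inr (.inl (i, ⟨s, hs⟩))))

theorem map_genQ (ω : AdmissibleInput F m n α β) :
    (genQ F m n α β).map (Pi.evalRingHom (fun _ => F) ω) = ω.Q :=
  map_gather (fun ω => by
    rw [mem_degreeLT_iff_coeff]
    exact fun s hs => coeff_eq_zero_of_natDegree_lt (by rw [ω.natDegree_eq]; omega)) ω

/-- Evaluation at `ω` is a ring homomorphism, and the remainder by a monic polynomial commutes with
it; so the generic computation specializes to every instance. -/
theorem coeff_sum_genU_mul (ω : AdmissibleInput F m n α β) (i : Fin β) (s : ℕ) :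
    (∑ k, genU F m n β k * ((genV F m n β k * genW F m n α i) %ₘ genQ F m n α β)).coeff s ω =
      (sumModProd ω.Q ω.U ω.V ω.W i).coeff s := by
  have hU : ∀ k, (genU F m n β k).map (Pi.evalRingHom (fun _ => F) ω) = ω.U k :=
    fun k => map_gather (fun ω => ω.U_mem k) ω
  have hV : ∀ k, (genV F m n β k).map (Pi.evalRingHom (fun _ => F) ω) = ω.V k :=
    fun k => map_gather (fun ω => ω.V_mem k) ω
  have hW : (genW F m n α i).map (Pi.evalRingHom (fun _ => F) ω) = ω.W i :=
    map_gather (fun ω => ω.W_mem i) ω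
  have hcoeff : ∀ f : (AdmissibleInput F m n α β → F)[X],
      f.coeff s ω = (f.map (Pi.evalRingHom (fun _ => F) ω)).coeff s := fun f => by
    rw [coeff_map]
    rfl
  have hQ : (genQ F m n α β).Monic := monic_genQ
  rw [hcoeff, Polynomial.map_sum]
  simp only [Polynomial.map_mul, map_modByMonic _ hQ, map_genQ, hU, hV, hW, sumModProd]

end AdmissibleInput

theorem theorem8 {F : Type*} [Field F]
    (M : ℕ → ℝ) (hM : IsMulTime F M)
    (Mmat : ℝ → ℕ → ℝ) (hMmat : IsMatMulTime F Mmat)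
    (c : ℝ) (hc : ∀ d : ℝ, 1 ≤ d → M ⌈d⌉₊ ≤ c * Mmat d 1) :
    ∃ C : ℝ, ∀ m n α β : ℕ, 0 < m → 0 < α → 0 < β → α ≤ n →
      ∃ P : SLP F (ProblemInput m n α β) (Fin β × Fin (m + n - 1)),
        (P.cost : ℝ) ≤
          C * (((max α β : ℕ) : ℝ) / ((min α β : ℕ) : ℝ) *
            MmatPrime Mmat (((max m n : ℕ) : ℝ) / ((min α β : ℕ) : ℝ)) (min α β)) ∧
        ∀ (Q : F[X]) (U V : Fin α → F[X]) (W : Fin β → F[X]),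
          Q.Monic → Q.natDegree = n →
          (∀ k, U k ∈ degreeLT F m) → (∀ k, V k ∈ degreeLT F n) → (∀ i, W i ∈ degreeLT F n) →
          (∀ i, sumModProd Q U V W i ∈ degreeLT F (m + n - 1)) ∧
          P.Yields (problemInput m n Q U V W)
            (fun t => (sumModProd Q U V W t.1).coeff t.2) := by
  refine ⟨389 * |c| + 184, fun m n α β _ hα hβ hαn => ?_⟩
  have hcomp := comp_sum_mul_modByMonic hM hMmat hc hα hβ hαn
    AdmissibleInput.monic_genQ (AdmissibleInput.natDegree_genQ (F := F) (m := m))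
    (fun k => gather_mem_degreeLT m _) (fun k => gather_mem_degreeLT n _)
    (fun i => gather_mem_degreeLT n _) AdmissibleInput.known_genQ AdmissibleInput.known_genU
    AdmissibleInput.known_genV AdmissibleInput.known_genW
  obtain ⟨P, hP, hyields⟩ := (hcomp.mono_right (T' := Set.range
      fun (t : Fin β × Fin (m + n - 1)) (ω : AdmissibleInput F m n α β) =>
        (sumModProd ω.Q ω.U ω.V ω.W t.1).coeff t.2) (by
    rintro _ ⟨t, rfl⟩
    refine subset_withConsts _ (Set.mem_iUnion.2 ⟨t.1, t.2, ?_⟩)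
    exact funext fun ω => AdmissibleInput.coeff_sum_genU_mul ω t.1 t.2)).exists_slp
  exact ⟨P, hP, fun Q U V W h₁ h₂ h₃ h₄ h₅ =>
    ⟨sumModProd_mem_degreeLT (hα.trans_le hαn) h₁ h₂ h₃,
      hyields ⟨Q, U, V, W, h₁, h₂, h₃, h₄, h₅⟩⟩⟩
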